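/- **Theorem 5.2 (Serre's duality).** Let $F$ be a number field with ring of integers $O_F$ and different $\partial$. An Arakelov divisor is a formal sum $D=\sum_P x_P P+\sum_\sigma x_\sigma\sigma$ over the nonzero primes $P$ of $O_F$ and the infinite places $\sigma$ of $F$, with $x_P\in\mathbb Z$ almost all zero and $x_\sigma\in\mathbb R$. Put $I_D=\prod_P P^{-x_P}$, a lattice in $F\otimes\mathbb R=\prod_{\sigma\text{ real}}\mathbb R\times\prod_{\sigma\text{ complex}}\mathbb C$, put $$\|z\|_D^2=\sum_{\sigma\text{ real}}e^{-2x_\sigma}|z_\sigma|^2+\sum_{\sigma\text{ complex}}2e^{-x_\sigma}|z_\sigma|^2\qquad(z\in F\otimes\mathbb R),$$ and $u_D(z)=e^{-\pi\|z\|_D^2}$. The canonical divisor $K$ has $I_K=\partial^{-1}$ and zero infinite coefficients. *Ghost-spaces.* Let $G$ be a locally compact abelian group. For a continuous, strictly positive, positive-definite $u:G\to\mathbb R$ with $u(0)=1$, the ghost-space of the first kind $G_u$ is $G$ with the convolution $\delta_x*\delta_y=\frac{u(x)u(y)}{u(x+y)}\delta_{x+y}$. For a positive-definite even probability measure $\mu$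 on $G$, the ghost-space of the second kind $G^\mu$ is $G$ with the convolution $\delta_x*\delta_y=T_{x+y}\mu$, where $T_z$ is translation by $z$. (A measure $\mu$ is positive-definite if $\int (f*f^\vee)\,d\mu\ge 0$ for all continuous compactly supported $f:G\to\mathbb C$, where $f^\vee(x)=\overline{f(-x)}$.) If $H\subseteq G$ is a closed subgroup with Haar measure $m$, then $G_u/H_u=(G/H)_v$ with $v(x+H)=\int_H u(x+y)\,dm(y)\big/\int_H u(y)\,dm(y)$, provided that the integrals converge and $(G/H)_v$ is a ghost-space of the first kind. If $u$ is integrable for a Haar measure $m$ of $G$, then $G/G_u=G^\mu$ with $\mu$ the probability measure proportional to $u\cdot m$. *Duals.* The dual $\widehat{G_u}$ is the space of symmetric quasi-characters of $G_u$, that is, of nonzero continuous $\varphi:G\to\mathbb C$ with $\varphi(x)\varphi(y)=\int\varphi\,d(\delta_x*\delta_y)$ and $\varphi(-x)=\overline{\varphi(x)}$, with the compact-open topology, the involution $\varphi\mapsto\overline\varphi$, and the convolution for which $\delta_\varphi*\delta_\psi$ is the bounded regular Borel measure $\nu$ such that $\varphi(x)\psi(x)=\int\eta(x)\,d\nu(\eta)$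 for all $x\in G$. Equivalently, through $\chi\mapsto\chi u$, it is $\widehat G^{\,\hat u}$, where $\hat u$ is the bounded regular Borel measure on $\widehat G$ with $u(x)=\int\chi(x)\,d\hat u(\chi)$ for all $x\in G$. *Statement.* Let $D$ be an Arakelov divisor, $I=I_D$, $u=u_D$. Then $I_{K-D}=\partial^{-1}I^{-1}$; the ghost-space of the first kind $H^0(K-D)=(\partial^{-1}I^{-1})_{u_{K-D}}$ is well defined; and all quotients in $$H^1(D)=\big((I\otimes\mathbb R)/I\big)\big/\big((I\otimes\mathbb R)_u/I_u\big)$$ are well defined, so that $H^1(D)=((I\otimes\mathbb R)/I)^\omega$ is a ghost-space of the second kind, where $\omega$ is the probability measure proportional to $\sum_{y\in I}e^{-\pi\|x+y\|_D^2}\cdot m$, with $m$ a Haar measure of $(I\otimes\mathbb R)/I$. Moreover $$H^1(D)=\widehat{H^0(K-D)}$$ as ghost-spaces. Precisely: $\overline x\mapsto\big(y\mapsto e^{2\pi i\,\mathrm{Tr}(xy)}\big)$, where $\mathrm{Tr}$ is the trace of the $\mathbb R$-algebra $F\otimes\mathbb R$, is an isomorphism of topological groups from $(I\otimes\mathbb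 R)/I$ onto the Pontryagin dual of $\partial^{-1}I^{-1}$; it maps $\omega$ to the Fourier transform $\widehat{u_{K-D}}$, which exists and is unique; and $\overline x\mapsto\big(y\mapsto e^{2\pi i\,\mathrm{Tr}(xy)}u_{K-D}(y)\big)$ is a homeomorphism from $(I\otimes\mathbb R)/I$ onto the space of symmetric quasi-characters of $H^0(K-D)$ that carries $-\overline x$ to the complex conjugate and carries the convolution of $H^1(D)$ to the dual convolution, which exists and is unique. -/

import Mathlib

open MeasureTheory NumberField IsDedekindDomain

open scoped nonZeroDivisors

noncomputable section

/-! ### Ghost-spaces -/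

namespace GhostSpace

/-- A convolution of measures on a space `X`, given (as usual for weakly separately continuous
convolutions) by its values `δ_x * δ_y` on pairs of point measures. -/
abbrev Convolution (X : Type*) [MeasurableSpace X] : Type _ := X → X → Measure X

section Groups

variable {G : Type*} [AddCommGroup G] [TopologicalSpace G]

open scoped ComplexOrder in
/-- Positive-definite functions: every matrix `f (x_j - x_i)` is hermitian and
nonnegative-definite. -/
def IsPositiveDefinite (f : G → ℂ) : Prop :=
  ∀ (n : ℕ) (x : Fin n → G), (Matrix.of fun i j => f (x j - x i)).PosSemidef

/-- The functions `u` that define a ghost-space of the first kind `G_u`. -/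
structure IsFirstKind (u : G → ℝ) : Prop where
  continuous : Continuous u
  pos : ∀ x, 0 < u x
  map_zero : u 0 = 1
  positiveDefinite : IsPositiveDefinite fun x => (u x : ℂ)

/-- The convolution of the ghost-space of the first kind `G_u`:
`δ_x * δ_y = (u x * u y / u (x + y)) δ_{x + y}`. -/
def firstKind [MeasurableSpace G] (u : G → ℝ) : Convolution G := fun x y =>
  ENNReal.ofReal (u x * u y / u (x + y)) • Measure.dirac (x + y)

/-- The convolution of the ghost-space of the second kind `G^μ`: `δ_x * δ_y = T_{x + y} μ`. -/
def secondKind [MeasurableSpace G] (μ : Measure G) : Convolution G := fun x y =>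
  μ.map fun z => x + y + z

variable [IsTopologicalAddGroup G] [LocallyCompactSpace G] [MeasurableSpace G] [BorelSpace G]

open scoped ComplexOrder in
/-- Positive-definite measures: `∫ (f * f^∨) dμ ≥ 0` for every continuous compactly supported `f`,
where `f^∨ x` is the complex conjugate of `f (-x)`. -/
def IsPositiveDefiniteMeasure (μ : Measure G) : Prop :=
  ∀ f : G → ℂ, Continuous f → HasCompactSupport f →
    0 ≤ ∫ x, (∫ y, f y * star (f (-(x - y))) ∂(Measure.addHaar : Measure G)) ∂μ

/-- The measures `μ` that define a ghost-space of the second kind `G^μ`. -/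
structure IsSecondKind (μ : Measure G) : Prop where
  probability : IsProbabilityMeasure μ
  even : μ.map (fun x => -x) = μ
  positiveDefinite : IsPositiveDefiniteMeasure μ

/-- `dim_m G_u` is finite. -/
def IsFiniteDimensional (u : G → ℝ) : Prop := Integrable u (Measure.addHaar : Measure G)

/-- The probability measure proportional to `u · m`, where `m` is a Haar measure of `G`. For a
finite-dimensional `G_u`, the quotient `G / G_u` is the ghost-space of the second kind defined by
this measure. -/
def quotientMeasure (u : G → ℝ) : Measure G :=
  ((Measure.addHaar : Measure G).withDensity (fun x => ENNReal.ofReal (u x)) Set.univ)⁻¹ •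
    (Measure.addHaar : Measure G).withDensity fun x => ENNReal.ofReal (u x)

section Quotient

variable (H : AddSubgroup G) [LocallyCompactSpace H]

/-- The function `v` on `G / H` given by
`v (x + H) = (∫_H u (x + y) dm(y)) / (∫_H u y dm(y))`, where `m` is a Haar measure of `H`. -/
def quotientFun (u : G → ℝ) : G ⧸ H → ℝ := fun q =>
  Quotient.liftOn' q
    (fun x => (∫ y : H, u (x + y) ∂(Measure.addHaar : Measure H)) /
      ∫ y : H, u y ∂(Measure.addHaar : Measure H))
    (by
      intro a b hab
      have hab' : -a + b ∈ H := QuotientAddGroup.leftRel_apply.mp hab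
      have h := integral_add_left_eq_self (μ := (Measure.addHaar : Measure H))
        (fun y : H => u (a + y)) ⟨-a + b, hab'⟩
      simp only [AddSubgroup.coe_add] at h
      simp only [← h, add_assoc, add_neg_cancel_left])

/-- The quotient `G_u / H_u` of ghost-spaces of the first kind is defined; it is then the
ghost-space of the first kind `(G / H)_v` for `v = quotientFun H u`. -/
structure HasQuotient (u : G → ℝ) : Prop where
  closed : IsClosed (H : Set G)
  firstKind : IsFirstKind u
  integrable : ∀ x : G, Integrable (fun y : H => u (x + y)) (Measure.addHaar : Measure H)
  quotient : IsFirstKind (quotientFun H u)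

end Quotient

end Groups

/-! ### Duality -/

/-- The Pontryagin dual of an additive topological group, written additively. -/
abbrev AddDual (G : Type*) [AddCommGroup G] [TopologicalSpace G] : Type _ :=
  Additive (PontryaginDual (Multiplicative G))

instance (G : Type*) [AddCommGroup G] [TopologicalSpace G] : MeasurableSpace (AddDual G) :=
  borel _

instance (G : Type*) [AddCommGroup G] [TopologicalSpace G] : BorelSpace (AddDual G) := ⟨rfl⟩

/-- The value `χ x` of a character. -/
def AddDual.eval {G : Type*} [AddCommGroup G] [TopologicalSpace G] (χ : AddDual G) (x : G) : ℂ :=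
  ((Additive.toMul χ) (Multiplicative.ofAdd x) : Circle)

/-- `ν` is the Fourier transform of `u`, that is, the bounded regular Borel measure on the dual
group such that `u x = ∫ χ x dν(χ)` for all `x`. -/
structure IsFourierTransform {G : Type*} [AddCommGroup G] [TopologicalSpace G]
    (u : G → ℝ) (ν : Measure (AddDual G)) : Prop where
  finite : IsFiniteMeasure ν
  regular : ν.Regular
  inversion : ∀ x : G, (u x : ℂ) = ∫ χ : AddDual G, χ.eval x ∂ν

section Dual

variable {X : Type*} [TopologicalSpace X] [MeasurableSpace X] [Neg X]

/-- Symmetric quasi-characters of a convolution: nonzero continuous functions with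
`φ x * φ y = ∫ φ d(δ_x * δ_y)` and `φ (-x) = conj (φ x)`. -/
structure IsSymmetricQuasiCharacter (c : Convolution X) (φ : C(X, ℂ)) : Prop where
  ne_zero : φ ≠ 0
  integrable : ∀ x y, Integrable φ (c x y)
  mul : ∀ x y, φ x * φ y = ∫ z, φ z ∂(c x y)
  symmetric : ∀ x, φ (-x) = star (φ x)

/-- The underlying space of the dual of a convolution: the symmetric quasi-characters, with the
compact-open topology. -/
abbrev QuasiDual (c : Convolution X) : Type _ := {φ : C(X, ℂ) // IsSymmetricQuasiCharacter c φ}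

instance (c : Convolution X) : MeasurableSpace (QuasiDual c) := borel _

instance (c : Convolution X) : BorelSpace (QuasiDual c) := ⟨rfl⟩

/-- `ν` is the convolution `δ_φ * δ_ψ` in the dual: the bounded regular Borel measure whose inverse
Fourier transform is the product of the inverse Fourier transforms of `δ_φ` and `δ_ψ`, that is, of
the functions `φ` and `ψ`. -/
structure IsDualConvolution {c : Convolution X} (φ ψ : QuasiDual c)
    (ν : Measure (QuasiDual c)) : Prop where
  finite : IsFiniteMeasure ν
  regular : ν.Regular
  inversion : ∀ x : X, φ.1 x * ψ.1 x = ∫ η : QuasiDual c, η.1 x ∂ν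

/-- The homeomorphism `Φ` identifies the convolution `d` on `Y` with the Pontryagin dual of the
convolution `c` on `X`: the involution `a ↦ -a` becomes complex conjugation of quasi-characters,
and the image of `δ_a * δ_b` is the one and only dual convolution of `Φ a` and `Φ b`. -/
structure IsDuality {Y : Type*} [TopologicalSpace Y] [MeasurableSpace Y] [Neg Y]
    (c : Convolution X) (d : Convolution Y) (Φ : Y ≃ₜ QuasiDual c) : Prop where
  map_neg : ∀ (a : Y) (x : X), (Φ (-a)).1 x = star ((Φ a).1 x)
  convolution : ∀ (a b : Y) (ν : Measure (QuasiDual c)),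
    IsDualConvolution (Φ a) (Φ b) ν ↔ ν = (d a b).map Φ

end Dual

end GhostSpace

/-! ### Arakelov divisors -/

open GhostSpace

/-- Arakelov divisors of `F`: an integer coefficient for each nonzero prime of the ring of integers,
almost all zero, and a real coefficient for each infinite place. -/
abbrev ArakelovDivisor (F : Type*) [Field F] [NumberField F] : Type _ :=
  (HeightOneSpectrum (𝓞 F) →₀ ℤ) × (InfinitePlace F → ℝ)

namespace ArakelovDivisor

variable {F : Type*} [Field F] [NumberField F]

/-- A nonzero prime as an invertible fractional ideal. -/
def primeUnit (P : HeightOneSpectrum (𝓞 F)) : (FractionalIdeal (𝓞 F)⁰ F)ˣ :=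
  Units.mk0 (P.asIdeal : FractionalIdeal (𝓞 F)⁰ F) (FractionalIdeal.coeIdeal_ne_zero.mpr P.ne_bot)

/-- The fractional ideal `I = ∏ P ^ (-x_P)` associated with a divisor. -/
def ideal (D : ArakelovDivisor F) : (FractionalIdeal (𝓞 F)⁰ F)ˣ :=
  D.1.prod fun P n => primeUnit P ^ (-n)

variable (F) in
/-- The canonical divisor: its coefficient at a prime `P` is the exponent of `P` in the different,
and its infinite coefficients are zero. -/
def canonical : ArakelovDivisor F :=
  (Finsupp.ofSupportFinite
    (fun P => FractionalIdeal.count F P (differentIdeal ℤ (𝓞 F) : FractionalIdeal (𝓞 F)⁰ F))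
    (FractionalIdeal.finite_factors _), 0)

/-- The fractional ideal `I` of `D`, embedded in `F ⊗ ℝ`. The algebra `F ⊗ ℝ = I ⊗ ℝ` is the mixed
space, the product of a copy of `ℝ` for each real place and of `ℂ` for each complex place. -/
def lattice (D : ArakelovDivisor F) : AddSubgroup (mixedEmbedding.mixedSpace F) :=
  (mixedEmbedding.idealLattice F D.ideal).toAddSubgroup

instance (D : ArakelovDivisor F) : DiscreteTopology D.lattice :=
  inferInstanceAs (DiscreteTopology (mixedEmbedding.idealLattice F D.ideal))

instance (D : ArakelovDivisor F) : IsClosed (D.lattice : Set (mixedEmbedding.mixedSpace F)) :=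
  AddSubgroup.isClosed_of_discrete

open scoped Classical in
/-- The hermitian metric `‖z‖²_D` on `F ⊗ ℝ`. -/
def normSq (D : ArakelovDivisor F) (z : mixedEmbedding.mixedSpace F) : ℝ :=
  ∑ w : {w : InfinitePlace F // w.IsReal}, |z.1 w| ^ 2 * Real.exp (-2 * D.2 w) +
    ∑ w : {w : InfinitePlace F // w.IsComplex}, ‖z.2 w‖ ^ 2 * (2 * Real.exp (-D.2 w))

/-- The function `u z = exp (-π ‖z‖²_D)` on `F ⊗ ℝ`. -/
def gaussian (D : ArakelovDivisor F) (z : mixedEmbedding.mixedSpace F) : ℝ :=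
  Real.exp (-Real.pi * D.normSq z)

/-- The restriction of `u` to `I`. -/
def effectivity (D : ArakelovDivisor F) : D.lattice → ℝ := fun y => D.gaussian y

/-- `H⁰(D)` is the ghost-space of the first kind `I_u`. -/
def H0 (D : ArakelovDivisor F) : Convolution D.lattice := firstKind D.effectivity

/-- The function `v` on `(I ⊗ ℝ) / I` with `(I ⊗ ℝ)_u / I_u = ((I ⊗ ℝ) / I)_v`. -/
def quotientGaussian (D : ArakelovDivisor F) : mixedEmbedding.mixedSpace F ⧸ D.lattice → ℝ :=
  quotientFun D.lattice D.gaussian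

/-- The measure `ω` on `(I ⊗ ℝ) / I` that defines the ghost-space
`((I ⊗ ℝ) / I) / ((I ⊗ ℝ)_u / I_u)`. -/
def omega (D : ArakelovDivisor F) : Measure (mixedEmbedding.mixedSpace F ⧸ D.lattice) :=
  quotientMeasure D.quotientGaussian

/-- `H¹(D) = ((I ⊗ ℝ) / I) / ((I ⊗ ℝ)_u / I_u)` is the ghost-space of the second kind
`((I ⊗ ℝ) / I)^ω`. -/
def H1 (D : ArakelovDivisor F) : Convolution (mixedEmbedding.mixedSpace F ⧸ D.lattice) :=
  secondKind D.omega

/-- All quotients of ghost-spaces in the definition of `H¹(D)` exist, and the result is a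
ghost-space of the second kind. -/
structure H1IsDefined (D : ArakelovDivisor F) : Prop where
  hasQuotient : HasQuotient D.lattice D.gaussian
  finiteDimensional : IsFiniteDimensional D.quotientGaussian
  secondKind : IsSecondKind D.omega

/-- The trace pairing `exp (2 π i Tr (x y))` on `F ⊗ ℝ`. -/
def tracePairing (x y : mixedEmbedding.mixedSpace F) : ℂ :=
  Complex.exp (2 * Real.pi * Complex.I * (Algebra.trace ℝ (mixedEmbedding.mixedSpace F) (x * y) : ℝ))

end ArakelovDivisor

end

noncomputable section

open mixedEmbedding GhostSpace

namespace ArakelovDivisor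

variable {F : Type*} [Field F] [NumberField F]

/-! ### Ideals of divisors -/

/-! The trace form makes the lattices of `D` and `K - D` dual to each other. By definition of the
different, `∂⁻¹ I⁻¹` is the trace dual of `I`, so the trace-dual basis of a ℤ-basis of `I` is a
ℤ-basis of it. Coordinates in the basis of `I` are therefore traces against the dual basis. Hence
`x` pairs integrally with the lattice of `K - D` exactly when `x ∈ I`, and arbitrary values of a
character on the dual basis are attained by some `x`. This yields a continuous bijective
homomorphism from the compact group `(I ⊗ ℝ)/I` to the Hausdorff dual group, hence a topological
isomorphism (`traceEquiv`).

The analytic core is `integral_traceEquiv_eval_omega`: the integral of the character of `y` against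
`ω` is `u_{K-D}(y)`. Since `ω` is a normalized periodized Gaussian, the integral unfolds to one over
`F ⊗ ℝ`, namely the Fourier transform of `u_D` at `y` divided by its value at zero. The weights at
the real and complex places are such that this quotient is the Gaussian with the opposite infinite
coefficients. Poisson summation is not needed.

Finite measures on the compact quotient are determined by their integrals against these characters
(Stone–Weierstrass), which gives uniqueness of the Fourier transform and of the dual convolution.
Symmetric quasi-characters of `G_u` are exactly the products `χ u` with `χ` a character. Translating
`ω` by `a + b` multiplies the integral of a character `χ` by `χ(a) χ(b)`, so the convolutions match.

Positive-definiteness has a single source: a Gaussian is, up to a constant, the autocorrelation of a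
narrower Gaussian, and this identity survives periodization. -/

theorem ideal_sub (D E : ArakelovDivisor F) : (D - E).ideal = D.ideal * E.ideal⁻¹ := by
  unfold ideal
  rw [Prod.fst_sub, sub_eq_add_neg, Finsupp.prod_add_index' (by simp) (fun P m n => by
    rw [neg_add, zpow_add]), Finsupp.prod_neg_index (by simp), Finsupp.prod, Finsupp.prod,
    Finsupp.prod, ← Finset.prod_inv_distrib]
  simp [zpow_neg]

theorem coe_ideal (D : ArakelovDivisor F) : (D.ideal : FractionalIdeal (𝓞 F)⁰ F) =
    (∏ᶠ P : HeightOneSpectrum (𝓞 F), (P.asIdeal : FractionalIdeal (𝓞 F)⁰ F) ^ D.1 P)⁻¹ := by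
  rw [finprod_eq_prod_of_mulSupport_subset (s := D.1.support)]
  · rw [ideal, Finsupp.prod, Units.coe_prod, ← Finset.prod_inv_distrib]
    simp [primeUnit]
  · intro P hP
    contrapose! hP
    simp_all

theorem coe_ideal_canonical : ((canonical F).ideal : FractionalIdeal (𝓞 F)⁰ F) =
    (differentIdeal ℤ (𝓞 F) : FractionalIdeal (𝓞 F)⁰ F)⁻¹ := by
  rw [coe_ideal]
  congr 1
  exact FractionalIdeal.finprod_heightOneSpectrum_factorization' F
    (FractionalIdeal.coeIdeal_ne_zero.mpr differentIdeal_ne_bot)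

theorem coe_ideal_canonical_sub (D : ArakelovDivisor F) :
    ((canonical F - D).ideal : FractionalIdeal (𝓞 F)⁰ F) =
      (differentIdeal ℤ (𝓞 F) : FractionalIdeal (𝓞 F)⁰ F)⁻¹ *
        (D.ideal : FractionalIdeal (𝓞 F)⁰ F)⁻¹ := by
  rw [ideal_sub, Units.val_mul, coe_ideal_canonical, Units.val_inv_eq_inv_val]

/-- This is where the different enters: its inverse is the trace dual of the ring of integers, so
`∂⁻¹ I⁻¹` is the trace dual of `I`. -/
theorem coe_ideal_canonical_sub_eq_dual (D : ArakelovDivisor F) :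
    ((canonical F - D).ideal : FractionalIdeal (𝓞 F)⁰ F) =
      FractionalIdeal.dual ℤ ℚ (D.ideal : FractionalIdeal (𝓞 F)⁰ F) := by
  rw [coe_ideal_canonical_sub, coeIdeal_differentIdeal ℤ ℚ, inv_inv,
    ← FractionalIdeal.dual_eq_mul_inv]

/-! ### Dual bases for the trace form -/

open Classical in
/-- The basis of `F` dual to the chosen `ℤ`-basis of the ideal of `D` for the trace form. -/
def dualIdealBasis (D : ArakelovDivisor F) :
    Module.Basis (Module.Free.ChooseBasisIndex ℤ D.ideal) ℚ F :=
  (basisOfFractionalIdeal F D.ideal).traceDual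

theorem span_dualIdealBasis (D : ArakelovDivisor F) :
    (((canonical F - D).ideal : FractionalIdeal (𝓞 F)⁰ F) : Submodule (𝓞 F) F).restrictScalars ℤ =
      Submodule.span ℤ (Set.range D.dualIdealBasis) := by
  classical
  rw [coe_ideal_canonical_sub_eq_dual, FractionalIdeal.coe_dual _ _ D.ideal.ne_zero]
  refine (Submodule.traceDual_span_of_basis ℤ _ (basisOfFractionalIdeal F D.ideal) ?_).trans ?_
  · ext x
    rw [mem_span_basisOfFractionalIdeal]
    rfl
  · unfold dualIdealBasis
    convert rfl

open Classical in
theorem trace_mul_dualIdealBasis (D : ArakelovDivisor F) (i j) :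
    Algebra.trace ℚ F (basisOfFractionalIdeal F D.ideal i * D.dualIdealBasis j) =
      if i = j then 1 else 0 := by
  have := Module.Basis.trace_mul_traceDual (basisOfFractionalIdeal F D.ideal) i j
  unfold dualIdealBasis
  convert this

/-- The basis of `F ⊗ ℝ` that spans the lattice of `D`. -/
def latticeBasis (D : ArakelovDivisor F) :
    Module.Basis (Module.Free.ChooseBasisIndex ℤ D.ideal) ℝ (mixedSpace F) :=
  fractionalIdealLatticeBasis F D.ideal

theorem latticeBasis_apply (D : ArakelovDivisor F) (i) :
    D.latticeBasis i = mixedEmbedding F (basisOfFractionalIdeal F D.ideal i) :=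
  fractionalIdealLatticeBasis_apply F D.ideal i

/-- A ℤ-basis of the unit ideal is a ℚ-basis of `F` and, once embedded, an ℝ-basis of the mixed
space. Multiplication by `a` has the same matrix in both. -/
theorem trace_mixedEmbedding (a : F) :
    Algebra.trace ℝ (mixedSpace F) (mixedEmbedding F a) = (Algebra.trace ℚ F a : ℝ) := by
  classical
  let b := basisOfFractionalIdeal F 1
  let b' := fractionalIdealLatticeBasis F 1
  have hb (i) : b' i = mixedEmbedding F (b i) := fractionalIdealLatticeBasis_apply F 1 i
  rw [Algebra.trace_eq_matrix_trace b, Algebra.trace_eq_matrix_trace b', Matrix.trace, Matrix.trace]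
  push_cast
  refine Finset.sum_congr rfl fun i _ => ?_
  simp only [Matrix.diag_apply, Algebra.leftMulMatrix_eq_repr_mul]
  have h : mixedEmbedding F a * b' i = ∑ j, (b.repr (a * b i) j : ℝ) • b' j := by
    rw [hb, ← map_mul, ← b.sum_repr (a * b i), map_sum]
    refine Finset.sum_congr rfl fun j _ => ?_
    rw [b.sum_repr, hb, Algebra.smul_def, map_mul, Algebra.smul_def]
    congr 1
    -- It remains to see that a rational scalar embedded through `F` and through `ℝ` gives the same
    -- element in each coordinate.
    refine Prod.ext (funext fun w => ?_) (funext fun w => ?_)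
    · simp [mixedEmbedding_apply_isReal]
    · simp [mixedEmbedding_apply_isComplex]
  rw [h, map_sum, Finsupp.finsetSum_apply]
  simp [Finsupp.single_apply]

open Classical in
theorem trace_latticeBasis_mul (D : ArakelovDivisor F) (i j) :
    Algebra.trace ℝ (mixedSpace F)
      (D.latticeBasis i * mixedEmbedding F (D.dualIdealBasis j)) = if i = j then 1 else 0 := by
  rw [latticeBasis_apply, ← map_mul, trace_mixedEmbedding, trace_mul_dualIdealBasis]
  split_ifs <;> simp

/-- The two bases are dual for the trace form. This turns integrality of traces into integrality of
coordinates. -/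
theorem latticeBasis_repr (D : ArakelovDivisor F) (x : mixedSpace F) (i) :
    D.latticeBasis.repr x i =
      Algebra.trace ℝ (mixedSpace F) (x * mixedEmbedding F (D.dualIdealBasis i)) := by
  classical
  conv_rhs => rw [← D.latticeBasis.sum_repr x, Finset.sum_mul, map_sum]
  simp only [smul_mul_assoc, map_smul, trace_latticeBasis_mul, smul_eq_mul, mul_ite, mul_one,
    mul_zero, Finset.sum_ite_eq', Finset.mem_univ, if_true]

theorem span_latticeBasis (D : ArakelovDivisor F) :
    Submodule.span ℤ (Set.range D.latticeBasis) = idealLattice F D.ideal :=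
  span_idealLatticeBasis F D.ideal

theorem mem_lattice_iff_mem_span (D : ArakelovDivisor F) {x : mixedSpace F} :
    x ∈ D.lattice ↔ x ∈ Submodule.span ℤ (Set.range D.latticeBasis) := by
  rw [span_latticeBasis]; rfl

theorem mem_lattice_iff (D : ArakelovDivisor F) {x : mixedSpace F} :
    x ∈ D.lattice ↔ ∃ y ∈ (D.ideal : FractionalIdeal (𝓞 F)⁰ F), mixedEmbedding F y = x :=
  mem_idealLattice F D.ideal

theorem dualIdealBasis_mem (D : ArakelovDivisor F) (i) :
    mixedEmbedding F (D.dualIdealBasis i) ∈ (canonical F - D).lattice := by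
  refine (mem_lattice_iff _).mpr ⟨_, ?_, rfl⟩
  have h : D.dualIdealBasis i ∈ Submodule.span ℤ (Set.range D.dualIdealBasis) :=
    Submodule.subset_span ⟨i, rfl⟩
  rw [← span_dualIdealBasis] at h
  exact h

theorem closure_range_dualIdealBasis (D : ArakelovDivisor F) :
    AddSubgroup.closure (Set.range fun i =>
      (⟨_, D.dualIdealBasis_mem i⟩ : (canonical F - D).lattice)) = ⊤ := by
  rw [eq_top_iff]
  rintro ⟨x, hx⟩ -
  obtain ⟨y, hy, rfl⟩ := (mem_lattice_iff _).mp hx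
  have hy' : y ∈ Submodule.span ℤ (Set.range D.dualIdealBasis) := by
    rw [← span_dualIdealBasis]; exact hy
  induction hy' using Submodule.span_induction with
  | mem y h =>
    obtain ⟨i, rfl⟩ := h
    exact AddSubgroup.subset_closure ⟨i, rfl⟩
  | zero =>
    rw [show (⟨mixedEmbedding F 0, hx⟩ : (canonical F - D).lattice) = 0 from
      Subtype.ext (map_zero _)]
    exact zero_mem _
  | add a b ha hb iha ihb =>
    rw [← span_dualIdealBasis] at ha hb
    have ha' := (mem_lattice_iff (canonical F - D)).mpr ⟨a, ha, rfl⟩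
    have hb' := (mem_lattice_iff (canonical F - D)).mpr ⟨b, hb, rfl⟩
    convert! add_mem (iha ha ha') (ihb hb hb') using 1
    simp
  | smul n a ha iha =>
    rw [← span_dualIdealBasis] at ha
    have ha' := (mem_lattice_iff (canonical F - D)).mpr ⟨a, ha, rfl⟩
    convert! zsmul_mem (iha ha ha') n using 1
    simp [Subtype.ext_iff]

theorem trace_mul_mem_int (D : ArakelovDivisor F) {x y : mixedSpace F} (hx : x ∈ D.lattice)
    (hy : y ∈ (canonical F - D).lattice) :
    ∃ n : ℤ, Algebra.trace ℝ (mixedSpace F) (x * y) = n := by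
  obtain ⟨a, ha, rfl⟩ := (mem_lattice_iff _).mp hx
  obtain ⟨b, hb, rfl⟩ := (mem_lattice_iff _).mp hy
  rw [coe_ideal_canonical_sub_eq_dual, FractionalIdeal.mem_dual D.ideal.ne_zero] at hb
  obtain ⟨n, hn⟩ := hb a ha
  refine ⟨n, ?_⟩
  rw [← map_mul, trace_mixedEmbedding, mul_comm a b, ← Algebra.traceForm_apply, ← hn]
  simp

theorem mem_lattice_of_trace_mem_int (D : ArakelovDivisor F) {x : mixedSpace F}
    (h : ∀ y ∈ (canonical F - D).lattice,
      ∃ n : ℤ, Algebra.trace ℝ (mixedSpace F) (x * y) = n) : x ∈ D.lattice := by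
  rw [mem_lattice_iff_mem_span, D.latticeBasis.mem_span_iff_repr_mem ℤ]
  intro i
  obtain ⟨n, hn⟩ := h _ (D.dualIdealBasis_mem i)
  exact ⟨n, by rw [latticeBasis_repr, hn]; simp⟩

end ArakelovDivisor

/-! ### Characters and the topology of the dual group -/

namespace GhostSpace.AddDual

variable {G : Type*} [AddCommGroup G] [TopologicalSpace G]

instance : T2Space (AddDual G) :=
  inferInstanceAs (T2Space (PontryaginDual (Multiplicative G)))

theorem ext_eval {χ ψ : AddDual G} (h : ∀ x, χ.eval x = ψ.eval x) : χ = ψ :=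
  PontryaginDual.ext fun a => Subtype.ext (h a)

@[simp]
theorem eval_zero (χ : AddDual G) : χ.eval 0 = 1 := by
  simp [eval]

theorem eval_add (χ : AddDual G) (x y : G) : χ.eval (x + y) = χ.eval x * χ.eval y := by
  simp [eval]

theorem eval_neg (χ : AddDual G) (x : G) : χ.eval (-x) = star (χ.eval x) := by
  simp only [eval, ofAdd_neg, map_inv, Circle.coe_inv_eq_conj]
  rfl

@[simp]
theorem add_eval (χ ψ : AddDual G) (x : G) : (χ + ψ).eval x = χ.eval x * ψ.eval x := rfl

theorem neg_eval (χ : AddDual G) (x : G) : (-χ).eval x = star (χ.eval x) := by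
  rw [← eval_neg]
  simp only [eval, ofAdd_neg, map_inv]
  rfl

theorem continuous_eval [LocallyCompactSpace G] :
    Continuous fun p : AddDual G × G => p.1.eval p.2 := by
  have h : Continuous fun p : PontryaginDual (Multiplicative G) × Multiplicative G => p.1 p.2 := by
    have h1 : Continuous fun p : C(Multiplicative G, Circle) × Multiplicative G => p.1 p.2 :=
      haveI : LocallyCompactSpace (Multiplicative G) := inferInstanceAs (LocallyCompactSpace G)
      ContinuousEval.continuous_eval
    exact h1.comp ((ContinuousMonoidHom.isInducing_toContinuousMap _ _).continuous.prodMap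
      continuous_id)
  exact continuous_subtype_val.comp h

/-- The character with the given values. -/
def mk (f : G → Circle) (hf : Continuous f) (h0 : f 0 = 1) (h : ∀ x y, f (x + y) = f x * f y) :
    AddDual G :=
  Additive.ofMul
    ({ toFun := fun a => f a.toAdd
       map_one' := h0
       map_mul' := fun a b => h a.toAdd b.toAdd
       continuous_toFun := hf } : Multiplicative G →ₜ* Circle)

@[simp]
theorem mk_eval (f : G → Circle) (hf : Continuous f) (h0 : f 0 = 1)
    (h : ∀ x y, f (x + y) = f x * f y) (x : G) : (mk f hf h0 h).eval x = f x := rfl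

theorem continuous_of_eval {X : Type*} [TopologicalSpace X] {f : X → AddDual G}
    (h : Continuous fun p : X × G => (f p.1).eval p.2) : Continuous f := by
  refine ContinuousMonoidHom.continuous_of_continuous_uncurry (B := Multiplicative G) f ?_
  exact Topology.IsInducing.subtypeVal.continuous_iff.mpr h

end GhostSpace.AddDual

/-! ### The compact quotient of `F ⊗ ℝ` by `I` as the dual of the lattice of `K - D` -/

theorem compactSpace_quotient_of_basis {V ι : Type*} [NormedAddCommGroup V] [NormedSpace ℝ V]
    [Finite ι] (b : Module.Basis ι ℝ V) (L : AddSubgroup V)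
    (hL : ∀ x ∈ Submodule.span ℤ (Set.range b), x ∈ L) : CompactSpace (V ⧸ L) := by
  have := b.finiteDimensional_of_finite
  have := FiniteDimensional.proper ℝ V
  cases nonempty_fintype ι
  have hK : IsCompact (closure (ZSpan.fundamentalDomain b)) :=
    (ZSpan.fundamentalDomain_isBounded b).isCompact_closure
  refine ⟨(hK.image (QuotientAddGroup.continuous_mk (N := L))).of_isClosed_subset
    isClosed_univ ?_⟩
  rintro q -
  obtain ⟨x, rfl⟩ := QuotientAddGroup.mk_surjective q
  refine ⟨ZSpan.fract b x, subset_closure (ZSpan.fract_mem_fundamentalDomain _ x), ?_⟩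
  refine QuotientAddGroup.eq.mpr (hL _ ?_)
  rw [ZSpan.fract_apply, neg_sub, sub_add_cancel]
  exact SetLike.coe_mem _

namespace ArakelovDivisor

variable {F : Type*} [Field F] [NumberField F]

instance (D : ArakelovDivisor F) : Countable D.lattice :=
  countable_of_Lindelof_of_discrete

instance (D : ArakelovDivisor F) : CompactSpace (mixedSpace F ⧸ D.lattice) := by
  classical
  refine compactSpace_quotient_of_basis D.latticeBasis D.lattice fun x hx => ?_
  exact D.mem_lattice_iff_mem_span.mpr hx

/-- Needed to apply `measure_ext_of_integral_eval_eq`, which compares measures on Polish spaces. -/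
instance (D : ArakelovDivisor F) : PolishSpace (mixedSpace F ⧸ D.lattice) :=
  letI := TopologicalSpace.metrizableSpaceMetric (mixedSpace F ⧸ D.lattice)
  inferInstance

omit [NumberField F] in
theorem tracePairing_eq_exp (x y : mixedSpace F) : tracePairing x y =
    Circle.exp (2 * Real.pi * Algebra.trace ℝ (mixedSpace F) (x * y)) := by
  rw [tracePairing, Circle.coe_exp]
  congr 1
  push_cast
  ring

theorem continuous_trace : Continuous (Algebra.trace ℝ (mixedSpace F)) :=
  LinearMap.continuous_of_finiteDimensional _

/-- The homomorphism `x ↦ exp (2 π i Tr (x y))` from `F ⊗ ℝ` to the dual of a lattice. -/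
def traceHom (L : AddSubgroup (mixedSpace F)) : mixedSpace F →+ AddDual L where
  toFun x := AddDual.mk
    (fun y => Circle.exp (2 * Real.pi * Algebra.trace ℝ (mixedSpace F) (x * y)))
    (by
      have := continuous_trace (F := F)
      fun_prop)
    (by rw [AddSubgroup.coe_zero, mul_zero, map_zero, mul_zero, Circle.exp_zero])
    (fun y z => by rw [AddSubgroup.coe_add, mul_add, map_add, mul_add, Circle.exp_add])
  map_zero' := AddDual.ext_eval fun y => by
    rw [AddDual.mk_eval, zero_mul, map_zero, mul_zero, Circle.exp_zero]
    rfl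
  map_add' x z := AddDual.ext_eval fun y => by
    rw [AddDual.mk_eval, add_mul, map_add, mul_add, Circle.exp_add]
    rfl

theorem traceHom_eval (L : AddSubgroup (mixedSpace F)) (x : mixedSpace F) (y : L) :
    (traceHom L x).eval y = tracePairing x y := by
  rw [tracePairing_eq_exp]; rfl

theorem continuous_traceHom (L : AddSubgroup (mixedSpace F)) : Continuous (traceHom L) := by
  refine AddDual.continuous_of_eval ?_
  simp only [traceHom_eval, tracePairing]
  have := continuous_trace (F := F)
  fun_prop

omit [NumberField F] in
theorem tracePairing_eq_one_iff (x y : mixedSpace F) : tracePairing x y = 1 ↔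
    ∃ n : ℤ, Algebra.trace ℝ (mixedSpace F) (x * y) = n := by
  rw [tracePairing, Complex.exp_eq_one_iff]
  have h : (2 * Real.pi * Complex.I : ℂ) ≠ 0 := Complex.two_pi_I_ne_zero
  refine exists_congr fun n => ?_
  rw [mul_comm (n : ℂ), mul_right_inj' h]
  norm_cast

theorem ker_traceHom (D : ArakelovDivisor F) :
    (traceHom (canonical F - D).lattice).ker = D.lattice := by
  ext x
  rw [AddMonoidHom.mem_ker]
  constructor
  · intro h
    refine D.mem_lattice_of_trace_mem_int fun y hy => ?_
    rw [← tracePairing_eq_one_iff, ← traceHom_eval (canonical F - D).lattice x ⟨y, hy⟩, h]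
    rfl
  · intro hx
    refine AddDual.ext_eval fun y => ?_
    rw [traceHom_eval, (tracePairing_eq_one_iff _ _).mpr (D.trace_mul_mem_int hx y.2)]
    rfl

theorem traceHom_surjective (D : ArakelovDivisor F) :
    Function.Surjective (traceHom (canonical F - D).lattice) := by
  classical
  intro χ
  choose θ hθ using fun i => Circle.exp_surjective
    (χ.toMul (Multiplicative.ofAdd ⟨_, D.dualIdealBasis_mem i⟩))
  -- The angle `θ i` of the character on the `i`-th dual basis vector, divided by `2π`, is the
  -- `i`-th coordinate that `x` must have.
  let x := ∑ i, (θ i / (2 * Real.pi)) • D.latticeBasis i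
  have hx (j) : 2 * Real.pi * Algebra.trace ℝ (mixedSpace F)
      (x * mixedEmbedding F (D.dualIdealBasis j)) = θ j := by
    rw [← D.latticeBasis_repr, D.latticeBasis.repr_sum_self]
    field_simp
  refine ⟨x, AddDual.ext_eval fun y => ?_⟩
  have hy : y ∈ AddSubgroup.closure (Set.range fun i =>
      (⟨_, D.dualIdealBasis_mem i⟩ : (canonical F - D).lattice)) := by
    rw [closure_range_dualIdealBasis]; trivial
  induction hy using AddSubgroup.closure_induction with
  | mem y h =>
    obtain ⟨i, rfl⟩ := h
    rw [traceHom_eval, tracePairing_eq_exp, hx, hθ]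
    rfl
  | zero => simp
  | add y z _ _ hy hz => rw [AddDual.eval_add, AddDual.eval_add, hy, hz]
  | neg y _ hy => rw [AddDual.eval_neg, AddDual.eval_neg, hy]

/-- The isomorphism of `(I ⊗ ℝ) / I` with the dual of the lattice of `K - D`. -/
def traceEquiv (D : ArakelovDivisor F) :
    (mixedSpace F ⧸ D.lattice) ≃ₜ+ AddDual (canonical F - D).lattice :=
  let e : (mixedSpace F ⧸ D.lattice) ≃+ AddDual (canonical F - D).lattice :=
    (QuotientAddGroup.quotientAddEquivOfEq D.ker_traceHom.symm).trans
      (QuotientAddGroup.quotientKerEquivOfSurjective _ D.traceHom_surjective)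
  have he : Continuous e :=
    (QuotientAddGroup.isQuotientMap_mk D.lattice).continuous_iff.mpr
      (continuous_traceHom (canonical F - D).lattice)
  { e with
    continuous_toFun := he
    -- The inverse is continuous because the source is compact and the target Hausdorff.
    continuous_invFun := (he.homeoOfEquivCompactToT2 (f := e.toEquiv)).symm.continuous }

theorem traceEquiv_mk_eval (D : ArakelovDivisor F) (x : mixedSpace F)
    (y : (canonical F - D).lattice) : (D.traceEquiv x).eval y = tracePairing x y :=
  traceHom_eval _ x y

end ArakelovDivisor

namespace GhostSpace

/-! ### Measures on a compact space of characters -/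

section Uniqueness

variable {X G : Type*} [TopologicalSpace X] [CompactSpace X] [PolishSpace X] [MeasurableSpace X]
  [BorelSpace X] [AddCommGroup G] [TopologicalSpace G]

/-- Evaluations at points of `G` are closed under products and conjugation and separate the points
of `X`, so their linear span is a point-separating star-subalgebra, and integrals over it determine
a finite measure. -/
theorem measure_ext_of_integral_eval_eq {f : X → AddDual G} (hf : Function.Injective f)
    (hc : ∀ y, Continuous fun x => (f x).eval y) {P Q : Measure X} [IsFiniteMeasure P]
    [IsFiniteMeasure Q] (h : ∀ y, ∫ x, (f x).eval y ∂P = ∫ x, (f x).eval y ∂Q) : P = Q := by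
  let ev : G → BoundedContinuousFunction X ℂ := fun y => .mkOfCompact ⟨_, hc y⟩
  let S : Submonoid (BoundedContinuousFunction X ℂ) :=
    { carrier := Set.range ev
      one_mem' := ⟨0, by ext x; simp [ev]⟩
      mul_mem' := by
        rintro _ _ ⟨y, rfl⟩ ⟨z, rfl⟩
        exact ⟨y + z, by ext x; simp [ev, AddDual.eval_add]⟩ }
  have hstar : star (S : Set (BoundedContinuousFunction X ℂ)) = S := by
    ext g
    constructor
    · rintro ⟨y, hy⟩
      exact ⟨-y, by rw [← star_star g, ← hy]; ext x; simp [ev, AddDual.eval_neg]⟩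
    · rintro ⟨y, rfl⟩
      exact ⟨-y, by ext x; simp [ev, AddDual.eval_neg]⟩
  refine ext_of_forall_mem_subalgebra_integral_eq_of_polish (𝕜 := ℂ)
    (A := StarAlgebra.adjoin ℂ (S : Set (BoundedContinuousFunction X ℂ))) ?_ fun g hg => ?_
  · intro x y hxy
    obtain ⟨z, hz⟩ : ∃ z, (f x).eval z ≠ (f y).eval z := by
      by_contra! H
      exact hxy (hf (AddDual.ext_eval H))
    exact ⟨_, ⟨_, ⟨ev z, StarAlgebra.subset_adjoin ℂ _ ⟨z, rfl⟩, rfl⟩, rfl⟩, hz⟩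
  -- The generated star-algebra is only the linear span, since the generators form a submonoid
  -- stable under `star`.
  · have hg' : g ∈ Submodule.span ℂ (S : Set (BoundedContinuousFunction X ℂ)) := by
      have h1 : g ∈ Algebra.adjoin ℂ (S : Set (BoundedContinuousFunction X ℂ)) := by
        have h2 := StarAlgebra.adjoin_toSubalgebra ℂ (S : Set (BoundedContinuousFunction X ℂ))
        rw [hstar, Set.union_self] at h2
        rw [← h2]
        exact hg
      have h3 : g ∈ Subalgebra.toSubmodule (Algebra.adjoin ℂ
        (S : Set (BoundedContinuousFunction X ℂ))) := h1
      rwa [Algebra.adjoin_eq_span, Submonoid.closure_eq] at h3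
    clear hg
    induction hg' using Submodule.span_induction with
    | mem g hg =>
      obtain ⟨y, rfl⟩ := hg
      exact h y
    | zero => simp
    | add a b _ _ ha hb =>
      simp only [BoundedContinuousFunction.coe_add, Pi.add_apply]
      rw [integral_add (a.integrable P) (b.integrable P), integral_add (a.integrable Q)
        (b.integrable Q), ha, hb]
    | smul c a _ ha =>
      simp only [BoundedContinuousFunction.coe_smul]
      rw [integral_smul, integral_smul, ha]

end Uniqueness

/-! ### Quasi-characters of ghost-spaces of the first kind -/

section QuasiCharacters

variable {G : Type*} [AddCommGroup G] [TopologicalSpace G] {u : G → ℝ}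

/-- The matrix of the points `0, x` is hermitian, and `u` is real. -/
theorem IsFirstKind.map_neg (hu : IsFirstKind u) (x : G) : u (-x) = u x := by
  have h := (hu.positiveDefinite 2 ![0, x]).1.apply 0 1
  simpa using h

variable [MeasurableSpace G] [BorelSpace G] [T1Space G]

theorem integral_firstKind (hu : IsFirstKind u) (φ : G → ℂ) (x y : G) :
    ∫ z, φ z ∂(firstKind u x y) = (u x * u y / u (x + y) : ℝ) * φ (x + y) := by
  have h : 0 ≤ u x * u y / u (x + y) :=
    div_nonneg (mul_nonneg (hu.pos x).le (hu.pos y).le) (hu.pos _).le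
  rw [firstKind, integral_smul_measure, integral_dirac, ENNReal.toReal_ofReal h, Complex.real_smul]

/-- The quasi-character `χ u`. -/
def toQuasiDual (hu : IsFirstKind u) (χ : AddDual G) : QuasiDual (firstKind u) :=
  ⟨⟨fun x => χ.eval x * u x, by
      have h1 : Continuous fun x => χ.eval x :=
        continuous_subtype_val.comp (map_continuous (Additive.toMul χ))
      have h2 := hu.continuous
      fun_prop⟩,
    { ne_zero := fun h => by simpa [hu.map_zero] using DFunLike.congr_fun h 0
      integrable := fun x y => by
        refine Integrable.smul_measure ?_ ENNReal.ofReal_ne_top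
        exact integrable_dirac enorm_lt_top
      mul := fun x y => by
        rw [integral_firstKind hu]
        have := (hu.pos (x + y)).ne'
        simp only [ContinuousMap.coe_mk, AddDual.eval_add]
        push_cast
        have : (u (x + y) : ℂ) ≠ 0 := by exact_mod_cast this
        field_simp
      symmetric := fun x => by
        simp [AddDual.eval_neg, hu.map_neg] }⟩

theorem toQuasiDual_injective (hu : IsFirstKind u) : Function.Injective (toQuasiDual hu) := by
  intro χ ψ h
  refine AddDual.ext_eval fun x => ?_
  have h1 : (toQuasiDual hu χ).1 x = (toQuasiDual hu ψ).1 x := by rw [h]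
  exact mul_right_cancel₀ (by exact_mod_cast (hu.pos x).ne') h1

/-- Dividing by `u` turns the quasi-character equation into multiplicativity; symmetry then gives
`|φ / u|² = c(x) c(-x) = c(0) = 1` for `c = φ / u`. -/
theorem toQuasiDual_surjective (hu : IsFirstKind u) : Function.Surjective (toQuasiDual hu) := by
  rintro ⟨φ, hφ⟩
  have hu0 (x : G) : (u x : ℂ) ≠ 0 := by exact_mod_cast (hu.pos x).ne'
  let c : G → ℂ := fun x => φ x / u x
  have hadd (x y : G) : c (x + y) = c x * c y := by
    have h := hφ.mul x y
    rw [integral_firstKind hu] at h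
    push_cast at h
    have := hu0 x
    have := hu0 y
    have := hu0 (x + y)
    simp only [c]
    field_simp at h ⊢
    linear_combination -h
  have hneg (x : G) : c (-x) = star (c x) := by
    simp only [c, hφ.symmetric, hu.map_neg]
    simp
  have h0 : c 0 = 1 := by
    obtain ⟨x, hx⟩ : ∃ x, φ x ≠ 0 := by
      by_contra! H
      exact hφ.ne_zero (ContinuousMap.ext H)
    have hcx : c x ≠ 0 := div_ne_zero hx (hu0 x)
    have h := hadd x 0
    rw [add_zero] at h
    exact (mul_eq_left₀ hcx).mp h.symm
  have hmem (x : G) : c x ∈ Submonoid.unitSphere ℂ := by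
    refine mem_sphere_zero_iff_norm.mpr ?_
    have h1 : c x * star (c x) = 1 := by rw [← hneg, ← hadd, add_neg_cancel, h0]
    have h2 : ((‖c x‖ ^ 2 : ℝ) : ℂ) = 1 := by
      rw [← h1, Complex.star_def, Complex.mul_conj']
      push_cast
      rfl
    have h3 : ‖c x‖ ^ 2 = 1 := by exact_mod_cast h2
    exact (pow_eq_one_iff_of_nonneg (norm_nonneg _) two_ne_zero).mp h3
  refine ⟨AddDual.mk (fun x => ⟨c x, hmem x⟩) ?_ (Subtype.ext h0)
    fun x y => Subtype.ext (hadd x y), ?_⟩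
  · refine Continuous.subtype_mk ?_ _
    have h2 := hu.continuous
    exact φ.continuous.div (by fun_prop) hu0
  · refine Subtype.ext (ContinuousMap.ext fun x => ?_)
    exact div_mul_cancel₀ _ (hu0 x)

theorem continuous_toQuasiDual [LocallyCompactSpace G] (hu : IsFirstKind u) :
    Continuous (toQuasiDual hu) := by
  refine Continuous.subtype_mk (ContinuousMap.continuous_of_continuous_uncurry _ ?_) _
  have h1 := AddDual.continuous_eval (G := G)
  have h2 := hu.continuous
  change Continuous fun p : AddDual G × G => p.1.eval p.2 * u p.2
  fun_prop

/-- When the dual group is compact, `χ ↦ χ u` is a homeomorphism onto the space of symmetric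
quasi-characters. -/
def quasiDualHomeomorph [LocallyCompactSpace G] [CompactSpace (AddDual G)] (hu : IsFirstKind u) :
    AddDual G ≃ₜ QuasiDual (firstKind u) :=
  Continuous.homeoOfEquivCompactToT2
    (f := Equiv.ofBijective _ ⟨toQuasiDual_injective hu, toQuasiDual_surjective hu⟩)
    (continuous_toQuasiDual hu)

end QuasiCharacters

end GhostSpace

namespace GhostSpace

/-! ### Positive-definite functions and measures -/

-- The quadratic form of the matrix at `c` is the integral of `|∑ j, c j * h (x j)|²`.
open scoped ComplexOrder in
theorem IsPositiveDefinite.of_integral {G α : Type*} [AddCommGroup G] [MeasurableSpace α]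
    {μ : Measure α} {k : G → ℝ} (h : G → α → ℝ)
    (hk : ∀ x y, k (x - y) = ∫ s, h x s * h y s ∂μ)
    (hi : ∀ x y, Integrable (fun s => h x s * h y s) μ) :
    IsPositiveDefinite fun x => (k x : ℂ) := by
  intro n x
  refine Matrix.PosSemidef.of_dotProduct_mulVec_nonneg ?_ fun c => ?_
  · ext i j
    simp only [Matrix.conjTranspose_apply, Matrix.of_apply, Complex.star_def, Complex.conj_ofReal,
      hk, mul_comm]
  · have h1 : star c ⬝ᵥ ((Matrix.of fun i j => (k (x j - x i) : ℂ)).mulVec c) =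
        ∫ s, ((Complex.normSq (∑ j, c j * h (x j) s) : ℝ) : ℂ) ∂μ := by
      have h2 (s : α) : ((Complex.normSq (∑ j, c j * h (x j) s) : ℝ) : ℂ) =
          ∑ i, ∑ j, (star (c i) * c j) * ((h (x j) s * h (x i) s : ℝ) : ℂ) := by
        rw [Complex.normSq_eq_conj_mul_self, map_sum, Finset.sum_mul_sum]
        refine Finset.sum_congr rfl fun i _ => Finset.sum_congr rfl fun j _ => ?_
        rw [map_mul, Complex.conj_ofReal, Complex.star_def]
        push_cast
        ring
      have h3 (i j : Fin n) : Integrable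
          (fun s => star (c i) * c j * ((h (x j) s * h (x i) s : ℝ) : ℂ)) μ :=
        ((hi (x j) (x i)).ofReal (𝕜 := ℂ)).const_mul _
      simp_rw [h2]
      rw [integral_finsetSum _ fun i _ => integrable_finsetSum _ fun j _ => h3 i j]
      simp only [dotProduct, Matrix.mulVec, Matrix.of_apply, Pi.star_apply]
      refine Finset.sum_congr rfl fun i _ => ?_
      rw [integral_finsetSum _ fun j _ => h3 i j, Finset.mul_sum]
      refine Finset.sum_congr rfl fun j _ => ?_
      rw [integral_const_mul, integral_complex_ofReal, hk]
      ring
    rw [h1, integral_complex_ofReal]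
    exact_mod_cast integral_nonneg fun s => Complex.normSq_nonneg _

/-! ### Probability measures with continuous density on a compact group -/

section Compact

variable {G : Type*} [AddCommGroup G] [TopologicalSpace G] [IsTopologicalAddGroup G]
  [CompactSpace G] [MeasurableSpace G] [BorelSpace G]

theorem integrable_of_continuous {X : Type*} [TopologicalSpace X] [CompactSpace X]
    [MeasurableSpace X] [OpensMeasurableSpace X] {μ : Measure X} [IsFiniteMeasureOnCompacts μ]
    {f : X → ℂ} (hf : Continuous f) : Integrable f μ :=
  hf.integrable_of_hasCompactSupport (HasCompactSupport.of_compactSpace f)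

theorem lintegral_ne_top_of_continuous {v : G → ℝ} (hv : Continuous v) :
    ∫⁻ x, ENNReal.ofReal (v x) ∂(Measure.addHaar : Measure G) ≠ ⊤ := by
  have h : Integrable v (Measure.addHaar : Measure G) :=
    hv.integrable_of_hasCompactSupport (HasCompactSupport.of_compactSpace v)
  exact h.lintegral_lt_top.ne

theorem lintegral_ne_zero_of_continuous {v : G → ℝ} (hv : Continuous v) (hpos : ∀ x, 0 < v x) :
    ∫⁻ x, ENNReal.ofReal (v x) ∂(Measure.addHaar : Measure G) ≠ 0 := by
  intro h
  rw [lintegral_eq_zero_iff (by fun_prop)] at h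
  have h1 : (Measure.addHaar : Measure G) Set.univ = 0 := by
    have h2 : ∀ᵐ x ∂(Measure.addHaar : Measure G), False := by
      filter_upwards [h] with x hx
      exact (hpos x).not_ge (ENNReal.ofReal_eq_zero.mp hx)
    simpa [ae_iff] using h2
  exact (isOpen_univ.measure_pos _ Set.univ_nonempty).ne' h1

theorem isProbabilityMeasure_quotientMeasure {v : G → ℝ} (hv : Continuous v)
    (hpos : ∀ x, 0 < v x) : IsProbabilityMeasure (quotientMeasure v) := by
  refine ⟨?_⟩
  rw [quotientMeasure, Measure.smul_apply, withDensity_apply _ MeasurableSet.univ,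
    Measure.restrict_univ, smul_eq_mul]
  exact ENNReal.inv_mul_cancel (lintegral_ne_zero_of_continuous hv hpos)
    (lintegral_ne_top_of_continuous hv)

theorem integral_quotientMeasure {v : G → ℝ} (hv : Continuous v) (hpos : ∀ x, 0 < v x)
    (g : G → ℂ) : ∫ x, g x ∂(quotientMeasure v) =
      ((∫ x, v x ∂(Measure.addHaar : Measure G))⁻¹ : ℝ) *
        ∫ x, g x * v x ∂(Measure.addHaar : Measure G) := by
  rw [quotientMeasure, integral_smul_measure, withDensity_apply _ MeasurableSet.univ,
    Measure.restrict_univ, ENNReal.toReal_inv, ← integral_eq_lintegral_of_nonneg_ae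
    (Filter.Eventually.of_forall fun x => (hpos x).le) hv.aestronglyMeasurable, Complex.real_smul]
  congr 1
  refine (integral_withDensity_eq_integral_smul (f := fun x => (v x).toNNReal)
    (by fun_prop) g).trans (integral_congr_ae (Filter.Eventually.of_forall fun x => ?_))
  simp only [NNReal.smul_def, Real.coe_toNNReal _ (hpos x).le, Complex.real_smul, mul_comm]

theorem map_neg_quotientMeasure {v : G → ℝ} (hv : Continuous v) (heven : ∀ x, v (-x) = v x) :
    (quotientMeasure v).map (fun x => -x) = quotientMeasure v := by
  rw [quotientMeasure, Measure.map_smul]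
  congr 1
  ext s hs
  rw [Measure.map_apply measurable_neg hs, withDensity_apply _ (measurable_neg hs),
    withDensity_apply _ hs, ← (Measure.measurePreserving_neg (Measure.addHaar : Measure G)
    ).setLIntegral_comp_preimage hs (by fun_prop)]
  simp [heven]

-- Writing the density as an autocorrelation of `h` and applying Fubini, the integral of `f * f^∨`
-- becomes a nonnegative multiple of `∫ |Φ|²`, where `Φ s = ∫ f z h(z - s)`. Fubini is harmless
-- here, as all integrands are continuous on compact spaces.
open scoped ComplexOrder in
theorem isPositiveDefiniteMeasure_quotientMeasure [SecondCountableTopology G] {v h : G → ℝ}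
    (hv : Continuous v) (hpos : ∀ x, 0 < v x) (hh : Continuous h)
    (hconv : ∀ x y, v (x - y) = ∫ s, h (x - s) * h (y - s) ∂(Measure.addHaar : Measure G)) :
    IsPositiveDefiniteMeasure (quotientMeasure v) := by
  intro f hf _
  set μ : Measure G := Measure.addHaar
  let Φ : G → ℂ := fun s => ∫ z, f z * h (z - s) ∂μ
  have hΦ : Continuous Φ := by
    have := continuous_parametric_integral_of_continuous (μ := μ)
      (f := fun s z => f z * (h (z - s) : ℂ)) (by fun_prop) (isCompact_univ (X := G))
    simpa only [Measure.restrict_univ] using this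
  have inner (y : G) : ∫ x, star (f (-(x - y))) * v x ∂μ = ∫ s, h (y - s) * star (Φ s) ∂μ := by
    calc ∫ x, star (f (-(x - y))) * v x ∂μ = ∫ z, star (f z) * v (y - z) ∂μ := by
          -- Substitute `x = y - z`.
          rw [← integral_sub_left_eq_self _ μ y]
          simp
      _ = ∫ z, ∫ s, star (f z) * (h (y - s) * h (z - s)) ∂μ ∂μ := by
          refine integral_congr_ae (Filter.Eventually.of_forall fun z => ?_)
          simp only [hconv]
          rw [integral_const_mul, ← integral_complex_ofReal]
          push_cast
          rfl
      _ = ∫ s, ∫ z, star (f z) * (h (y - s) * h (z - s)) ∂μ ∂μ :=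
          integral_integral_swap (integrable_of_continuous (by fun_prop))
      _ = ∫ s, h (y - s) * star (Φ s) ∂μ := by
          refine integral_congr_ae (Filter.Eventually.of_forall fun s => ?_)
          simp only [Φ, Complex.star_def, ← integral_conj]
          rw [← integral_const_mul]
          refine integral_congr_ae (Filter.Eventually.of_forall fun z => ?_)
          simp only [map_mul, Complex.conj_ofReal]
          ring
  have key : ∫ x, (∫ y, f y * star (f (-(x - y))) ∂μ) * v x ∂μ =
      ((∫ s, Complex.normSq (Φ s) ∂μ : ℝ) : ℂ) := by
    calc ∫ x, (∫ y, f y * star (f (-(x - y))) ∂μ) * v x ∂μ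
        = ∫ x, ∫ y, f y * star (f (-(x - y))) * v x ∂μ ∂μ := by
          simp_rw [integral_mul_const]
      _ = ∫ y, ∫ x, f y * star (f (-(x - y))) * v x ∂μ ∂μ :=
          integral_integral_swap (integrable_of_continuous (by fun_prop))
      _ = ∫ y, ∫ s, f y * (h (y - s) * star (Φ s)) ∂μ ∂μ := by
          simp_rw [mul_assoc, integral_const_mul, inner]
      _ = ∫ s, ∫ y, f y * (h (y - s) * star (Φ s)) ∂μ ∂μ :=
          integral_integral_swap (integrable_of_continuous (by fun_prop))
      _ = ∫ s, ((Complex.normSq (Φ s) : ℝ) : ℂ) ∂μ := by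
          simp_rw [← mul_assoc, integral_mul_const, Complex.star_def, ← Complex.mul_conj]
          rfl
      _ = _ := integral_complex_ofReal
  rw [integral_quotientMeasure hv hpos, key, ← Complex.ofReal_mul]
  have h1 : 0 ≤ ∫ x, v x ∂μ := integral_nonneg fun x => (hpos x).le
  have h2 : 0 ≤ ∫ s, Complex.normSq (Φ s) ∂μ := integral_nonneg fun s => Complex.normSq_nonneg _
  exact_mod_cast mul_nonneg (inv_nonneg.mpr h1) h2

end Compact

end GhostSpace

/-! ### Unfolding over a lattice -/

section Unfolding

theorem QuotientAddGroup.automorphize_mk {G M : Type*} [AddCommGroup G] [AddCommMonoid M]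
    [TopologicalSpace M] [T2Space M] {L : AddSubgroup G} (f : G → M) (x : G) :
    QuotientAddGroup.automorphize f (x : G ⧸ L) = ∑' y : L, f (x + y) :=
  (L.equivOp.tsum_eq fun a : L.op => f (a +ᵥ x)).symm

variable {V ι : Type*} [NormedAddCommGroup V] [NormedSpace ℝ V] [Finite ι] [MeasurableSpace V]
  [BorelSpace V] (b : Module.Basis ι ℝ V) {L : AddSubgroup V}

include b in
theorem ZSpan.isAddFundamentalDomain_op
    (hL : ∀ x, x ∈ L ↔ x ∈ Submodule.span ℤ (Set.range b)) (μ : Measure V) :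
    IsAddFundamentalDomain L.op (ZSpan.fundamentalDomain b) μ := by
  refine IsAddFundamentalDomain.mk'
    (ZSpan.fundamentalDomain_measurableSet b).nullMeasurableSet fun x => ?_
  obtain ⟨v, hv, huniq⟩ := ZSpan.exist_unique_vadd_mem_fundamentalDomain b x
  refine ⟨L.equivOp ⟨v, (hL _).mpr v.2⟩, ?_, fun g hg => ?_⟩
  · convert! hv using 1
    exact add_comm _ _
  · obtain ⟨w, rfl⟩ := L.equivOp.surjective g
    have h := huniq ⟨w, (hL _).mp w.2⟩ (by convert! hg using 1; exact add_comm _ _)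
    congr 1
    exact Subtype.ext (Subtype.ext_iff.mp h :)

-- Summing over cosets and integrating over the quotient is integrating over `V`. The constant
-- compares the chosen Haar measure with the image of `μ` on a fundamental domain; only its
-- positivity matters, since it cancels in every later use.
include b in
theorem exists_integral_eq_integral_automorphize [FiniteDimensional ℝ V] [Countable L]
    [IsClosed (L : Set V)] [CompactSpace (V ⧸ L)]
    (hL : ∀ x, x ∈ L ↔ x ∈ Submodule.span ℤ (Set.range b))
    (μ : Measure V) [μ.IsAddHaarMeasure] :
    ∃ c : ℝ, 0 < c ∧ ∀ f : V → ℂ, Integrable f μ →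
      Continuous (QuotientAddGroup.automorphize f : V ⧸ L → ℂ) →
      ∀ g : V ⧸ L → ℂ, Continuous g →
      ∫ x : V ⧸ L, g x * QuotientAddGroup.automorphize f x ∂Measure.addHaar =
        c * ∫ x, g (x : V ⧸ L) * f x ∂μ := by
  have := FiniteDimensional.proper ℝ V
  have h𝓕 := ZSpan.isAddFundamentalDomain_op b hL μ
  have hfin : μ (ZSpan.fundamentalDomain b) < ⊤ :=
    (ZSpan.fundamentalDomain_isBounded b).measure_lt_top
  have : Fact (μ (ZSpan.fundamentalDomain b) < ⊤) := ⟨hfin⟩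
  set ν : Measure (V ⧸ L) :=
    (μ.restrict (ZSpan.fundamentalDomain b)).map (QuotientAddGroup.mk : V → V ⧸ L) with hν
  have : IsFiniteMeasure ν := Measure.isFiniteMeasure_map _ _
  have : HasAddFundamentalDomain L.op V μ := ⟨_, h𝓕⟩
  have : AddQuotientMeasureEqMeasurePreimage μ ν := h𝓕.addQuotientMeasureEqMeasurePreimage rfl
  have hHaar : ν.IsAddHaarMeasure :=
    AddQuotientMeasureEqMeasurePreimage.addHaarMeasure_quotient μ
  obtain ⟨c, hc, hsmul⟩ : ∃ c : NNReal, 0 < c ∧ (Measure.addHaar : Measure (V ⧸ L)) = c • ν :=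
    ⟨_, Measure.addHaarScalarFactor_pos_of_isAddHaarMeasure _ _,
      Measure.isAddLeftInvariant_eq_smul _ ν⟩
  refine ⟨c, hc, fun f hf hfc g hg => ?_⟩
  rw [QuotientAddGroup.integral_mul_eq_integral_automorphize_mul h𝓕 hf hg.aestronglyMeasurable ?_
    hfc.aestronglyMeasurable]
  · rw [hsmul, integral_smul_nnreal_measure]
    rfl
  -- The unfolding theorem wants `g` essentially bounded; it is continuous on a compact space.
  · obtain ⟨C, hC⟩ := isCompact_univ.exists_bound_of_continuousOn hg.continuousOn
    refine ((essSup_le_of_ae_le (ENNReal.ofReal C) (Filter.Eventually.of_forall fun x => ?_)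
      ).trans_lt ENNReal.ofReal_lt_top).ne
    rw [← ofReal_norm]
    exact ENNReal.ofReal_le_ofReal (hC x trivial)

end Unfolding

/-! ### Haar measure of a countable discrete group -/

theorem addHaar_eq_smul_count {G : Type*} [AddGroup G] [TopologicalSpace G]
    [IsTopologicalAddGroup G] [DiscreteTopology G] [Countable G] [MeasurableSpace G]
    [BorelSpace G] (μ : Measure G) [μ.IsAddHaarMeasure] :
    μ = μ {0} • Measure.count := by
  refine Measure.ext_of_singleton fun x => ?_
  rw [Measure.addHaar_singleton, Measure.smul_apply, Measure.count_singleton, smul_eq_mul, mul_one]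

theorem integrable_addHaar_of_summable {G : Type*} [AddGroup G] [TopologicalSpace G]
    [IsTopologicalAddGroup G] [DiscreteTopology G] [Countable G] [MeasurableSpace G]
    [BorelSpace G] (μ : Measure G) [μ.IsAddHaarMeasure] {f : G → ℝ} (hf : Summable f) :
    Integrable f μ := by
  rw [addHaar_eq_smul_count μ]
  exact (integrable_count_iff.mpr hf.norm).smul_measure isCompact_singleton.measure_lt_top.ne

theorem integral_addHaar_eq_tsum {G : Type*} [AddGroup G] [TopologicalSpace G]
    [IsTopologicalAddGroup G] [DiscreteTopology G] [Countable G] [MeasurableSpace G]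
    [BorelSpace G] (μ : Measure G) [μ.IsAddHaarMeasure] {f : G → ℝ} (hf : Summable f) :
    ∫ x, f x ∂μ = μ.real {0} * ∑' x, f x := by
  rw [integral_countable (integrable_addHaar_of_summable μ hf), ← tsum_mul_left]
  simp [Measure.real, Measure.addHaar_singleton]

/-! ### Gaussian functions -/

/-- Continuous positive-definite quadratic functions on a normed space. -/
structure IsPositiveQuadratic {V : Type*} [NormedAddCommGroup V] (q : V → ℝ) : Prop where
  continuous : Continuous q
  parallelogram : ∀ x y, q (x + y) + q (x - y) = 2 * q x + 2 * q y
  coercive : ∃ c > 0, ∀ x, c * ‖x‖ ^ 2 ≤ q x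

namespace IsPositiveQuadratic

variable {V : Type*} [NormedAddCommGroup V] {q : V → ℝ} (hq : IsPositiveQuadratic q)
include hq

theorem map_zero : q 0 = 0 := by
  have := hq.parallelogram 0 0
  simp only [add_zero, sub_zero] at this
  linarith

theorem map_neg (x : V) : q (-x) = q x := by
  have := hq.parallelogram 0 x
  simp only [zero_add, zero_sub, hq.map_zero] at this
  linarith

theorem nonneg (x : V) : 0 ≤ q x := by
  obtain ⟨c, hc, h⟩ := hq.coercive
  exact (by positivity : 0 ≤ c * ‖x‖ ^ 2).trans (h x)

theorem map_half [NormedSpace ℝ V] (x : V) : q ((1 / 2 : ℝ) • x) = q x / 4 := by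
  have h := hq.parallelogram ((1 / 2 : ℝ) • x) ((1 / 2 : ℝ) • x)
  rw [← add_smul, sub_self, hq.map_zero] at h
  norm_num at h ⊢
  linarith

/-- The parallelogram law for `x + y` and `x` gives `q y ≤ 2 q (x + y) + 2 q x`. The bound separates
`x` from `y`, as needed for domination locally uniform in `x`. -/
theorem exp_add_le {t : ℝ} (ht : 0 ≤ t) (x y : V) :
    Real.exp (-t * q (x + y)) ≤ Real.exp (t * q x) * Real.exp (-(t / 2) * q y) := by
  rw [← Real.exp_add, Real.exp_le_exp]
  have h := hq.parallelogram (x + y) x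
  rw [add_sub_cancel_left] at h
  have := hq.nonneg (x + y + x)
  nlinarith

/-- Decay faster than any power yields both integrability over `V` and summability over lattices. -/
theorem exp_mul_pow_le {t : ℝ} (ht : 0 < t) (n : ℕ) :
    ∃ C : ℝ, ∀ x, Real.exp (-t * q x) * (1 + ‖x‖) ^ n ≤ C := by
  obtain ⟨c, hc, h⟩ := hq.coercive
  have ha : 0 < t * c := mul_pos ht hc
  -- The constant comes from `s ^ n / n! ≤ exp s` at `s = t c (1 + ‖x‖²)` and `1 + ‖x‖ ≤ 2 (1 +
  -- ‖x‖²)`; the factor `exp (t c)` pays for replacing `‖x‖²` by `1 + ‖x‖²`.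
  refine ⟨Real.exp (t * c) * (n.factorial * (2 / (t * c)) ^ n), fun x => ?_⟩
  have h1 : (1 + ‖x‖) ≤ 2 * (1 + ‖x‖ ^ 2) := by nlinarith [norm_nonneg x, sq_nonneg (‖x‖ - 1)]
  have h2 := Real.pow_div_factorial_le_exp (t * c * (1 + ‖x‖ ^ 2)) (by positivity) n
  have h3 : Real.exp (-t * q x) ≤
      Real.exp (t * c) * (Real.exp (t * c * (1 + ‖x‖ ^ 2)))⁻¹ := by
    rw [← Real.exp_neg, ← Real.exp_add, Real.exp_le_exp]
    nlinarith [h x]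
  have hn : (0 : ℝ) < n.factorial := by positivity
  rw [div_le_iff₀ hn, mul_pow] at h2
  have h4 : (1 + ‖x‖) ^ n ≤
      n.factorial * (2 / (t * c)) ^ n * Real.exp (t * c * (1 + ‖x‖ ^ 2)) := by
    calc (1 + ‖x‖) ^ n ≤ (2 * (1 + ‖x‖ ^ 2)) ^ n := by gcongr
      _ = (2 / (t * c)) ^ n * ((t * c) ^ n * (1 + ‖x‖ ^ 2) ^ n) := by
          rw [mul_pow, div_pow]; field_simp
      _ ≤ (2 / (t * c)) ^ n * (Real.exp (t * c * (1 + ‖x‖ ^ 2)) * n.factorial) := by gcongr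
      _ = _ := by ring
  calc Real.exp (-t * q x) * (1 + ‖x‖) ^ n
      ≤ (Real.exp (t * c) * (Real.exp (t * c * (1 + ‖x‖ ^ 2)))⁻¹) *
        (n.factorial * (2 / (t * c)) ^ n * Real.exp (t * c * (1 + ‖x‖ ^ 2))) := by gcongr
    _ = _ := by
        have := (Real.exp_pos (t * c * (1 + ‖x‖ ^ 2))).ne'
        field_simp

variable [NormedSpace ℝ V] [FiniteDimensional ℝ V]

theorem integrable_exp [MeasurableSpace V] [BorelSpace V] (μ : Measure V) [μ.IsAddHaarMeasure]
    {t : ℝ} (ht : 0 < t) : Integrable (fun x => Real.exp (-t * q x)) μ := by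
  obtain ⟨C, hC⟩ := hq.exp_mul_pow_le ht (Module.finrank ℝ V + 1)
  have h1 : Integrable (fun x : V => (1 + ‖x‖) ^ (-((Module.finrank ℝ V + 1 : ℕ) : ℝ))) μ :=
    integrable_one_add_norm (by push_cast; linarith)
  have hc := hq.continuous
  refine (h1.const_mul C).mono' (by fun_prop) (Filter.Eventually.of_forall fun x => ?_)
  rw [Real.norm_of_nonneg (Real.exp_pos _).le, Real.rpow_neg (by positivity), Real.rpow_natCast,
    ← div_eq_mul_inv, le_div_iff₀ (by positivity)]
  exact hC x

variable (L : AddSubgroup V) [DiscreteTopology L]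

theorem summable_exp {t : ℝ} (ht : 0 < t) : Summable fun y : L => Real.exp (-t * q y) := by
  let M : Submodule ℤ V := AddSubgroup.toIntSubmodule L
  have : DiscreteTopology M := inferInstanceAs (DiscreteTopology L)
  obtain ⟨C, hC⟩ := hq.exp_mul_pow_le ht (Module.finrank ℤ M + 1)
  have h1 : Summable fun y : L => C * ‖y‖⁻¹ ^ (Module.finrank ℤ M + 1) :=
    (ZLattice.summable_norm_pow_inv M (Module.finrank ℤ M + 1) (Nat.lt_succ_self _)).mul_left C
  refine h1.of_norm_bounded_eventually ?_
  -- At the origin the comparison series has the default value `0⁻¹ = 0`, so that point is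
  -- discarded.
  filter_upwards [(Set.finite_singleton (0 : L)).compl_mem_cofinite] with y hy
  have hy0 : 0 < ‖(y : V)‖ := norm_pos_iff.mpr fun h => hy (Subtype.ext h)
  rw [Real.norm_of_nonneg (Real.exp_pos _).le, AddSubgroup.coe_norm, inv_pow, ← div_eq_mul_inv,
    le_div_iff₀ (by positivity)]
  refine le_trans ?_ (hC y)
  gcongr
  linarith

theorem summable_exp_add {t : ℝ} (ht : 0 < t) (x : V) :
    Summable fun y : L => Real.exp (-t * q (x + y)) :=
  ((hq.summable_exp L (half_pos ht)).mul_left _).of_nonneg_of_le (fun _ => (Real.exp_pos _).le)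
    fun y => hq.exp_add_le ht.le x y

omit hq [NormedSpace ℝ V] [FiniteDimensional ℝ V] [DiscreteTopology L] in
variable (q) in
/-- The sum of a Gaussian function over the cosets of a lattice. -/
def theta (t : ℝ) : V ⧸ L → ℝ := QuotientAddGroup.automorphize fun x => Real.exp (-t * q x)

omit hq [NormedSpace ℝ V] [FiniteDimensional ℝ V] [DiscreteTopology L] in
theorem theta_mk (t : ℝ) (x : V) : theta q L t x = ∑' y : L, Real.exp (-t * q (x + y)) :=
  QuotientAddGroup.automorphize_mk _ x

omit hq [NormedSpace ℝ V] [FiniteDimensional ℝ V] [DiscreteTopology L] in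
theorem automorphize_ofReal_exp (t : ℝ) (x : V ⧸ L) :
    QuotientAddGroup.automorphize (fun x : V => ((Real.exp (-t * q x) : ℝ) : ℂ)) x =
      theta q L t x := by
  obtain ⟨x, rfl⟩ := QuotientAddGroup.mk_surjective x
  rw [QuotientAddGroup.automorphize_mk, theta_mk, Complex.ofReal_tsum]

theorem theta_pos {t : ℝ} (ht : 0 < t) (x : V ⧸ L) : 0 < theta q L t x := by
  obtain ⟨x, rfl⟩ := QuotientAddGroup.mk_surjective x
  rw [theta_mk]
  exact (hq.summable_exp_add L ht x).tsum_pos (fun y => (Real.exp_pos _).le) 0 (Real.exp_pos _)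

omit [NormedSpace ℝ V] [FiniteDimensional ℝ V] [DiscreteTopology L] in
theorem theta_neg (t : ℝ) (x : V ⧸ L) : theta q L t (-x) = theta q L t x := by
  obtain ⟨x, rfl⟩ := QuotientAddGroup.mk_surjective x
  rw [← QuotientAddGroup.mk_neg, theta_mk, theta_mk, ← (Equiv.neg L).tsum_eq]
  refine tsum_congr fun y => ?_
  rw [Equiv.neg_apply, AddSubgroup.coe_neg, ← neg_add, hq.map_neg]

theorem continuous_theta {t : ℝ} (ht : 0 < t) : Continuous (theta q L t) := by
  refine (QuotientAddGroup.isQuotientMap_mk L).continuous_iff.mpr ?_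
  have hc := hq.continuous
  refine continuous_iff_continuousAt.mpr fun x₀ => ?_
  -- On this neighbourhood of `x₀` the factor `exp (t q x)` of `exp_add_le` is bounded, so the
  -- series converges uniformly.
  have hU : {x | q x < q x₀ + 1} ∈ nhds x₀ :=
    (isOpen_lt hc continuous_const).mem_nhds (by simp)
  refine ContinuousOn.continuousAt (s := {x | q x < q x₀ + 1}) ?_ hU
  have h : ContinuousOn (fun x => ∑' y : L, Real.exp (-t * q (x + y))) {x | q x < q x₀ + 1} := by
    refine continuousOn_tsum (fun y => Continuous.continuousOn (by fun_prop))
      ((hq.summable_exp L (half_pos ht)).mul_left (Real.exp (t * (q x₀ + 1)))) fun y x hx => ?_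
    rw [Real.norm_of_nonneg (Real.exp_pos _).le]
    refine (hq.exp_add_le ht.le x y).trans ?_
    have : q x ≤ q x₀ + 1 := le_of_lt hx
    gcongr
  exact h.congr fun x _ => theta_mk L t x

-- Completing the square: the parallelogram law for `s - w/2` and `w/2`. The dependence on `w`
-- splits off, so integrating over `s` makes a Gaussian an autocorrelation.
omit [FiniteDimensional ℝ V] in
theorem exp_mul_exp (t : ℝ) (w s : V) :
    Real.exp (-(2 * t) * q (w - s)) * Real.exp (-(2 * t) * q s) =
      Real.exp (-t * q w) * Real.exp (-(4 * t) * q (s - (1 / 2 : ℝ) • w)) := by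
  rw [← Real.exp_add, ← Real.exp_add]
  congr 1
  have h := hq.parallelogram (s - (1 / 2 : ℝ) • w) ((1 / 2 : ℝ) • w)
  rw [sub_add_cancel, sub_sub, ← add_smul, hq.map_half] at h
  norm_num at h
  have h2 := hq.map_neg (s - w)
  rw [neg_sub] at h2
  rw [h2]
  norm_num
  linear_combination (-2 * t) * h

variable [MeasurableSpace V] [BorelSpace V] (μ : Measure V) [μ.IsAddHaarMeasure]

theorem integral_exp_pos {t : ℝ} (ht : 0 < t) : 0 < ∫ x, Real.exp (-t * q x) ∂μ :=
  MeasureTheory.integral_exp_pos (hq.integrable_exp μ ht)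

omit [FiniteDimensional ℝ V] in
theorem integral_exp_mul_exp (t : ℝ) (w : V) :
    ∫ s, Real.exp (-(2 * t) * q (w - s)) * Real.exp (-(2 * t) * q s) ∂μ =
      Real.exp (-t * q w) * ∫ s, Real.exp (-(4 * t) * q s) ∂μ := by
  simp_rw [hq.exp_mul_exp]
  rw [integral_const_mul, integral_sub_right_eq_self fun s => Real.exp (-(4 * t) * q s)]

theorem integrable_exp_mul_exp {t : ℝ} (ht : 0 < t) (w : V) :
    Integrable (fun s => Real.exp (-(2 * t) * q (w - s)) * Real.exp (-(2 * t) * q s)) μ := by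
  simp_rw [hq.exp_mul_exp]
  exact ((hq.integrable_exp μ (by linarith : 0 < 4 * t)).comp_sub_right _).const_mul _

theorem isFirstKind_exp {t : ℝ} (ht : 0 < t) : IsFirstKind fun x => Real.exp (-t * q x) where
  continuous := by have := hq.continuous; fun_prop
  pos x := Real.exp_pos _
  map_zero := by simp [hq.map_zero]
  positiveDefinite := by
    borelize V
    let μ : Measure V := Measure.addHaar
    set K := ∫ s, Real.exp (-(4 * t) * q s) ∂μ with hKdef
    have hK : 0 < K := hq.integral_exp_pos μ (by linarith)
    -- Translating `s` by `y` leaves a function of `x - y`; the factor `K⁻¹`, split as two square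
    -- roots, normalizes the autocorrelation.
    have key (x y s : V) : Real.sqrt K⁻¹ * Real.exp (-(2 * t) * q (x - s)) *
        (Real.sqrt K⁻¹ * Real.exp (-(2 * t) * q (y - s))) = K⁻¹ *
        (Real.exp (-(2 * t) * q (x - y - (s - y))) * Real.exp (-(2 * t) * q (s - y))) := by
      rw [mul_mul_mul_comm, Real.mul_self_sqrt (by positivity), ← hq.map_neg (y - s), neg_sub,
        sub_sub_sub_cancel_right]
    refine IsPositiveDefinite.of_integral (μ := μ)
      (fun x s => Real.sqrt K⁻¹ * Real.exp (-(2 * t) * q (x - s))) (fun x y => ?_) fun x y => ?_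
    · simp_rw [key]
      rw [integral_const_mul, integral_sub_right_eq_self fun s =>
        Real.exp (-(2 * t) * q (x - y - s)) * Real.exp (-(2 * t) * q s),
        hq.integral_exp_mul_exp μ, ← hKdef]
      field_simp
    · simp_rw [key]
      exact ((hq.integrable_exp_mul_exp μ ht (x - y)).comp_sub_right y).const_mul _

end IsPositiveQuadratic

/-! ### Periodized Gaussians on the compact quotient -/

namespace IsPositiveQuadratic

variable {V ι : Type*} [NormedAddCommGroup V] [NormedSpace ℝ V] [FiniteDimensional ℝ V]
  [MeasurableSpace V] [BorelSpace V] [Finite ι] {q : V → ℝ} (hq : IsPositiveQuadratic q)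
  (b : Module.Basis ι ℝ V) (L : AddSubgroup V) [DiscreteTopology L]
include hq

section Quotient

variable [LocallyCompactSpace L] [Countable L]

omit [BorelSpace V] in
theorem integrable_exp_add [BorelSpace L] {t : ℝ} (ht : 0 < t) (x : V) :
    Integrable (fun y : L => Real.exp (-t * q (x + y))) (Measure.addHaar : Measure L) :=
  integrable_addHaar_of_summable _ (hq.summable_exp_add L ht x)

/-- Each integral over `L` is a lattice sum times the Haar mass of a point, and this nonzero finite
mass cancels. -/
theorem quotientFun_exp {t : ℝ} (ht : 0 < t) (x : V ⧸ L) :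
    quotientFun L (fun x => Real.exp (-t * q x)) x = theta q L t x / theta q L t 0 := by
  obtain ⟨x, rfl⟩ := QuotientAddGroup.mk_surjective x
  have h0 := integral_addHaar_eq_tsum (Measure.addHaar : Measure L) (hq.summable_exp L ht)
  have hx := integral_addHaar_eq_tsum (Measure.addHaar : Measure L) (hq.summable_exp_add L ht x)
  have hθ : theta q L t 0 = ∑' y : L, Real.exp (-t * q y) := by
    simpa using theta_mk (q := q) L t 0
  change (∫ y : L, Real.exp (-t * q (x + y)) ∂(Measure.addHaar : Measure L)) /
      (∫ y : L, Real.exp (-t * q y) ∂(Measure.addHaar : Measure L)) = _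
  rw [h0, hx, theta_mk, hθ, mul_div_mul_left]
  refine ENNReal.toReal_ne_zero.mpr ⟨?_, isCompact_singleton.measure_lt_top.ne⟩
  exact ((isOpen_discrete _).measure_pos _ (Set.singleton_nonempty _)).ne'

end Quotient

variable [Countable L] [IsClosed (L : Set V)] [CompactSpace (V ⧸ L)]
  (hL : ∀ x, x ∈ L ↔ x ∈ Submodule.span ℤ (Set.range b))

include b hL in
theorem exists_integral_mul_theta (μ : Measure V) [μ.IsAddHaarMeasure] {t : ℝ} (ht : 0 < t) :
    ∃ c : ℝ, 0 < c ∧ ∀ g : V ⧸ L → ℂ, Continuous g →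
      ∫ x : V ⧸ L, g x * theta q L t x ∂Measure.addHaar =
        c * ∫ x, g (x : V ⧸ L) * Real.exp (-t * q x) ∂μ := by
  obtain ⟨c, hc, h⟩ := exists_integral_eq_integral_automorphize b hL μ
  refine ⟨c, hc, fun g hg => ?_⟩
  have hθ : (QuotientAddGroup.automorphize (fun x : V => ((Real.exp (-t * q x) : ℝ) : ℂ)) :
      V ⧸ L → ℂ) = fun x => (theta q L t x : ℂ) :=
    funext fun x => automorphize_ofReal_exp L t x
  have := h (fun x => ((Real.exp (-t * q x) : ℝ) : ℂ)) (hq.integrable_exp μ ht).ofReal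
    (by rw [hθ]; exact Complex.continuous_ofReal.comp (hq.continuous_theta L ht)) g hg
  rw [hθ] at this
  exact this

-- The autocorrelation identity for Gaussians, periodized: one theta factor is unfolded to an
-- integral over `V`, the other is expanded over `L`, and each term is evaluated by
-- `integral_exp_mul_exp`.
include b hL in
theorem exists_theta_sub_eq_integral {t : ℝ} (ht : 0 < t) : ∃ C : ℝ, 0 < C ∧ ∀ x y : V ⧸ L,
    theta q L t (x - y) =
      C * ∫ s, theta q L (2 * t) (x - s) * theta q L (2 * t) (y - s) ∂Measure.addHaar := by
  let μ : Measure V := Measure.addHaar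
  have ht2 : 0 < 2 * t := by linarith
  obtain ⟨c, hc, h⟩ := hq.exists_integral_mul_theta b L hL μ ht2
  set K := ∫ s, Real.exp (-(4 * t) * q s) ∂μ with hKdef
  have hK : 0 < K := hq.integral_exp_pos μ (by linarith)
  have hcont := hq.continuous_theta L ht2
  refine ⟨(c * K)⁻¹, by positivity, fun x y => ?_⟩
  rw [eq_inv_mul_iff_mul_eq₀ (by positivity)]
  -- Translate `s` by `y` and use that theta is even.
  have h1 : ∫ s, theta q L (2 * t) (x - s) * theta q L (2 * t) (y - s) ∂Measure.addHaar =
      ∫ s, theta q L (2 * t) (x - y - s) * theta q L (2 * t) s ∂Measure.addHaar := by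
    rw [← integral_add_right_eq_self
      (fun s => theta q L (2 * t) (x - s) * theta q L (2 * t) (y - s)) y]
    refine integral_congr_ae (Filter.Eventually.of_forall fun s => ?_)
    simp only
    rw [sub_add_cancel_right, hq.theta_neg L, add_comm s y, sub_sub]
  rw [h1]
  obtain ⟨z, hz⟩ := QuotientAddGroup.mk_surjective (x - y)
  rw [← hz]
  have h2 := h (fun s => (theta q L (2 * t) ((z : V ⧸ L) - s) : ℂ)) (by fun_prop)
  norm_cast at h2
  have h3 : HasSum (fun y : L => ∫ s, Real.exp (-(2 * t) * q (z + y - s)) *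
        Real.exp (-(2 * t) * q s) ∂μ)
      (∫ s, ∑' y : L, Real.exp (-(2 * t) * q (z + y - s)) * Real.exp (-(2 * t) * q s) ∂μ) := by
    refine hasSum_integral_of_summable_integral_norm
      (fun y => hq.integrable_exp_mul_exp μ ht _) ?_
    simp only [norm_mul, Real.norm_of_nonneg (Real.exp_pos _).le]
    simp_rw [hq.integral_exp_mul_exp μ]
    exact (hq.summable_exp_add L ht z).mul_right _
  have h4 : ∫ s, theta q L (2 * t) ((z : V ⧸ L) - (s : V ⧸ L)) * Real.exp (-(2 * t) * q s) ∂μ =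
      theta q L t z * K := by
    rw [theta_mk, ← tsum_mul_right]
    simp_rw [hq.integral_exp_mul_exp μ] at h3
    rw [h3.tsum_eq]
    refine integral_congr_ae (Filter.Eventually.of_forall fun s => ?_)
    simp only [← QuotientAddGroup.mk_sub, theta_mk]
    rw [← tsum_mul_right]
    simp only [sub_add_eq_add_sub]
  rw [h2, h4]
  ring

-- One autocorrelation serves twice: for positive-definiteness of the quotient function and of the
-- measure with that density.
include b hL in
theorem exists_quotientFun_sub_eq_integral {t : ℝ} (ht : 0 < t) : ∃ h : V ⧸ L → ℝ,
    Continuous h ∧ ∀ x y : V ⧸ L, quotientFun L (fun x => Real.exp (-t * q x)) (x - y) =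
      ∫ s, h (x - s) * h (y - s) ∂Measure.addHaar := by
  obtain ⟨C, hC, h⟩ := hq.exists_theta_sub_eq_integral b L hL ht
  have h0 := hq.theta_pos L ht 0
  have hcont := hq.continuous_theta L (by linarith : 0 < 2 * t)
  refine ⟨fun x => Real.sqrt (C / theta q L t 0) * theta q L (2 * t) x, by fun_prop,
    fun x y => ?_⟩
  simp_rw [mul_mul_mul_comm _ (theta q L (2 * t) _), Real.mul_self_sqrt (div_pos hC h0).le]
  rw [hq.quotientFun_exp L ht, h, integral_const_mul]
  ring

omit [IsClosed (L : Set V)] [CompactSpace (V ⧸ L)] in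
theorem continuous_quotientFun {t : ℝ} (ht : 0 < t) :
    Continuous (quotientFun L fun x => Real.exp (-t * q x)) := by
  rw [funext (hq.quotientFun_exp L ht)]
  exact (hq.continuous_theta L ht).div_const _

omit [IsClosed (L : Set V)] [CompactSpace (V ⧸ L)] in
theorem quotientFun_pos {t : ℝ} (ht : 0 < t) (x : V ⧸ L) :
    0 < quotientFun L (fun x => Real.exp (-t * q x)) x := by
  rw [hq.quotientFun_exp L ht]
  exact div_pos (hq.theta_pos L ht _) (hq.theta_pos L ht _)

include b hL in
theorem isFirstKind_quotientFun {t : ℝ} (ht : 0 < t) :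
    IsFirstKind (quotientFun L fun x => Real.exp (-t * q x)) where
  continuous := hq.continuous_quotientFun L ht
  pos := hq.quotientFun_pos L ht
  map_zero := by rw [hq.quotientFun_exp L ht, div_self (hq.theta_pos L ht 0).ne']
  positiveDefinite := by
    obtain ⟨h, hcont, hconv⟩ := hq.exists_quotientFun_sub_eq_integral b L hL ht
    refine IsPositiveDefinite.of_integral (μ := Measure.addHaar) (fun x s => h (x - s)) hconv
      fun x y => ?_
    exact Continuous.integrable_of_hasCompactSupport (by fun_prop)
      (HasCompactSupport.of_compactSpace _)

include b hL in
theorem isSecondKind_quotientMeasure {t : ℝ} (ht : 0 < t) :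
    IsSecondKind (quotientMeasure (quotientFun L fun x => Real.exp (-t * q x))) where
  probability := isProbabilityMeasure_quotientMeasure (hq.continuous_quotientFun L ht)
    (hq.quotientFun_pos L ht)
  even := map_neg_quotientMeasure (hq.continuous_quotientFun L ht)
    (hq.isFirstKind_quotientFun b L hL ht).map_neg
  positiveDefinite := by
    obtain ⟨h, hcont, hconv⟩ := hq.exists_quotientFun_sub_eq_integral b L hL ht
    exact isPositiveDefiniteMeasure_quotientMeasure (hq.continuous_quotientFun L ht)
      (hq.quotientFun_pos L ht) hcont hconv

include b hL in
theorem integral_quotientMeasure_quotientFun {t : ℝ} (ht : 0 < t) (μ : Measure V)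
    [μ.IsAddHaarMeasure] {g : V ⧸ L → ℂ} (hg : Continuous g) :
    ∫ x, g x ∂(quotientMeasure (quotientFun L fun x => Real.exp (-t * q x))) =
      (∫ x, g (x : V ⧸ L) * Real.exp (-t * q x) ∂μ) / ∫ x, (Real.exp (-t * q x) : ℂ) ∂μ := by
  obtain ⟨c, hc, h⟩ := hq.exists_integral_mul_theta b L hL μ ht
  rw [integral_quotientMeasure (hq.continuous_quotientFun L ht) (hq.quotientFun_pos L ht)]
  have h0 := hq.theta_pos L ht 0
  -- Unfolding with `g = 1` gives the normalizing integral, so `c` and the theta value at zero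
  -- cancel in the ratio.
  have h1 := h 1 continuous_const
  have h2 := h g hg
  have hK := hq.integral_exp_pos μ ht
  simp_rw [hq.quotientFun_exp L ht]
  simp only [Pi.one_apply, one_mul] at h1
  rw [integral_div]
  simp only [Complex.ofReal_inv, Complex.ofReal_div, ← mul_div_assoc]
  rw [integral_div, h2, ← integral_complex_ofReal, h1]
  have hK' : ∫ x, (Real.exp (-t * q x) : ℂ) ∂μ ≠ 0 := by
    rw [integral_complex_ofReal]; exact_mod_cast hK.ne'
  have hc' : (c : ℂ) ≠ 0 := by exact_mod_cast hc.ne'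
  have h0' : (theta q L t 0 : ℂ) ≠ 0 := by exact_mod_cast h0.ne'
  field_simp

end IsPositiveQuadratic

/-! ### The trace of the mixed space and Fourier transforms of Gaussian functions -/

theorem Algebra.trace_pi_eq_sum {ι R : Type*} [Fintype ι] [CommRing R] (S : ι → Type*)
    [∀ i, CommRing (S i)] [∀ i, Algebra R (S i)] [∀ i, Module.Free R (S i)]
    [∀ i, Module.Finite R (S i)] (x : ∀ i, S i) :
    Algebra.trace R (∀ i, S i) x = ∑ i, Algebra.trace R (S i) (x i) := by
  classical
  let b (i : ι) := Module.Free.chooseBasis R (S i)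
  rw [Algebra.trace_eq_matrix_trace (Pi.basis b), Matrix.trace, Fintype.sum_sigma]
  refine Finset.sum_congr rfl fun i _ => ?_
  rw [Algebra.trace_eq_matrix_trace (b i), Matrix.trace]
  refine Finset.sum_congr rfl fun j _ => ?_
  simp [Algebra.leftMulMatrix_eq_repr_mul]

theorem integral_cexp_gaussian_mul {V : Type*} [NormedAddCommGroup V] [InnerProductSpace ℝ V]
    [FiniteDimensional ℝ V] [MeasurableSpace V] [BorelSpace V] {a : ℝ} (ha : 0 < a) (w : V) :
    ∫ v : V, Complex.exp (2 * Real.pi * Complex.I * (inner ℝ w v : ℝ)) *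
        (Real.exp (-Real.pi * (‖v‖ ^ 2 * a)) : ℂ) =
      (Real.exp (-Real.pi * (‖w‖ ^ 2 * a⁻¹)) : ℂ) *
        ∫ v : V, (Real.exp (-Real.pi * (‖v‖ ^ 2 * a)) : ℂ) := by
  have hb : 0 < ((Real.pi * a : ℝ) : ℂ).re := by
    rw [Complex.ofReal_re]; exact mul_pos Real.pi_pos ha
  have h1 := GaussianFourier.integral_cexp_neg_mul_sq_norm_add hb (2 * Real.pi * Complex.I) w
  -- The same formula without linear term produces the same power of `π / b`, which therefore need
  -- not be evaluated.
  have h0 := GaussianFourier.integral_cexp_neg_mul_sq_norm_add hb 0 w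
  have e1 (v : V) : Complex.exp (2 * Real.pi * Complex.I * (inner ℝ w v : ℝ)) *
      (Real.exp (-Real.pi * (‖v‖ ^ 2 * a)) : ℂ) = Complex.exp (-((Real.pi * a : ℝ) : ℂ) *
        (‖v‖ : ℂ) ^ 2 + 2 * Real.pi * Complex.I * (inner ℝ w v : ℝ)) := by
    rw [Complex.ofReal_exp, ← Complex.exp_add]
    congr 1
    push_cast
    ring
  have e0 (v : V) : (Real.exp (-Real.pi * (‖v‖ ^ 2 * a)) : ℂ) =
      Complex.exp (-((Real.pi * a : ℝ) : ℂ) * (‖v‖ : ℂ) ^ 2 + 0 * (inner ℝ w v : ℝ)) := by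
    rw [Complex.ofReal_exp]
    congr 1
    push_cast
    ring
  simp_rw [e1]
  rw [h1, integral_congr_ae (Filter.Eventually.of_forall e0), h0, Complex.ofReal_exp]
  have ha' : (a : ℂ) ≠ 0 := by exact_mod_cast ha.ne'
  have hpi : (Real.pi : ℂ) ≠ 0 := by exact_mod_cast Real.pi_ne_zero
  have e2 : (2 * Real.pi * Complex.I) ^ 2 * (‖w‖ : ℂ) ^ 2 / (4 * ((Real.pi * a : ℝ) : ℂ)) =
      ((-Real.pi * (‖w‖ ^ 2 * a⁻¹) : ℝ) : ℂ) := by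
    push_cast
    field_simp
    rw [Complex.I_sq]
    ring
  rw [e2]
  simp [mul_comm]

section Product

variable {ι κ : Type*} [Fintype ι] [Fintype κ] {a : ι → ℝ} {b : κ → ℝ}

theorem isPositiveQuadratic_sum (ha : ∀ i, 0 < a i) (hb : ∀ j, 0 < b j) :
    IsPositiveQuadratic fun z : (ι → ℝ) × (κ → ℂ) =>
      ∑ i, |z.1 i| ^ 2 * a i + ∑ j, ‖z.2 j‖ ^ 2 * b j where
  continuous := by fun_prop
  parallelogram x y := by
    have h1 (i : ι) : |(x + y).1 i| ^ 2 * a i + |(x - y).1 i| ^ 2 * a i =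
        2 * (|x.1 i| ^ 2 * a i) + 2 * (|y.1 i| ^ 2 * a i) := by
      simp only [sq_abs, Prod.fst_add, Prod.fst_sub, Pi.add_apply, Pi.sub_apply]
      ring
    have h2 (j : κ) : ‖(x + y).2 j‖ ^ 2 * b j + ‖(x - y).2 j‖ ^ 2 * b j =
        2 * (‖x.2 j‖ ^ 2 * b j) + 2 * (‖y.2 j‖ ^ 2 * b j) := by
      have h := parallelogram_law_with_norm ℝ (x.2 j) (y.2 j)
      simp only [Prod.snd_add, Prod.snd_sub, Pi.add_apply, Pi.sub_apply]
      linear_combination b j * h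
    simp only [mul_add, Finset.mul_sum]
    rw [add_add_add_comm, add_add_add_comm (∑ i, 2 * (|x.1 i| ^ 2 * a i))]
    simp only [← Finset.sum_add_distrib, h1, h2]
  coercive := by
    have hA : 0 ≤ ∑ i, (a i)⁻¹ := Finset.sum_nonneg fun i _ => (inv_pos.mpr (ha i)).le
    have hB : 0 ≤ ∑ j, (b j)⁻¹ := Finset.sum_nonneg fun j _ => (inv_pos.mpr (hb j)).le
    -- `C` dominates every inverse weight, so each squared coordinate is at most `C * Q`, which
    -- suffices for the sup norm. The `1` keeps `C` positive for empty index sets.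
    set C := ∑ i, (a i)⁻¹ + ∑ j, (b j)⁻¹ + 1 with hCdef
    have hC : 0 < C := by positivity
    refine ⟨C⁻¹, inv_pos.mpr hC, fun z => ?_⟩
    have hR (i : ι) : 0 ≤ |z.1 i| ^ 2 * a i := mul_nonneg (by positivity) (ha i).le
    have hI (j : κ) : 0 ≤ ‖z.2 j‖ ^ 2 * b j := mul_nonneg (by positivity) (hb j).le
    have hR' := Finset.sum_nonneg fun i (_ : i ∈ Finset.univ) => hR i
    have hI' := Finset.sum_nonneg fun j (_ : j ∈ Finset.univ) => hI j
    set Q := ∑ i, |z.1 i| ^ 2 * a i + ∑ j, ‖z.2 j‖ ^ 2 * b j with hQdef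
    have hQ : 0 ≤ Q := add_nonneg hR' hI'
    have bound {s c : ℝ} (hc : 0 < c) (h1 : s ^ 2 * c ≤ Q) (h2 : c⁻¹ ≤ C) :
        s ≤ Real.sqrt (C * Q) := by
      refine Real.le_sqrt_of_sq_le ?_
      calc s ^ 2 = c⁻¹ * (s ^ 2 * c) := by field_simp
        _ ≤ C * Q := by gcongr
    have hz : ‖z‖ ≤ Real.sqrt (C * Q) := by
      refine norm_prod_le_iff.mpr ⟨(pi_norm_le_iff_of_nonneg (Real.sqrt_nonneg _)).mpr fun i => ?_,
        (pi_norm_le_iff_of_nonneg (Real.sqrt_nonneg _)).mpr fun j => ?_⟩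
      · refine bound (ha i) ?_ ?_
        · rw [Real.norm_eq_abs]
          have := Finset.single_le_sum (fun i _ => hR i) (Finset.mem_univ i)
          linarith
        · have := Finset.single_le_sum (fun i _ => (inv_pos.mpr (ha i)).le) (Finset.mem_univ i)
          linarith
      · refine bound (hb j) ?_ ?_
        · have := Finset.single_le_sum (fun j _ => hI j) (Finset.mem_univ j)
          linarith
        · have := Finset.single_le_sum (fun j _ => (inv_pos.mpr (hb j)).le) (Finset.mem_univ j)
          linarith
    rw [inv_mul_le_iff₀ hC]
    exact (pow_le_pow_left₀ (norm_nonneg z) hz 2).trans (Real.sq_sqrt (by positivity)).le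

theorem integral_prod_cexp_gaussian_mul (ha : ∀ i, 0 < a i) (hb : ∀ j, 0 < b j) (r : ι → ℝ)
    (c : κ → ℂ) :
    ∫ x : (ι → ℝ) × (κ → ℂ),
      ((∏ i, Complex.exp (2 * Real.pi * Complex.I * (inner ℝ (r i) (x.1 i) : ℝ))) *
        ∏ j, Complex.exp (2 * Real.pi * Complex.I * (inner ℝ (c j) (x.2 j) : ℝ))) *
      ((∏ i, (Real.exp (-Real.pi * (‖x.1 i‖ ^ 2 * a i)) : ℂ)) *
        ∏ j, (Real.exp (-Real.pi * (‖x.2 j‖ ^ 2 * b j)) : ℂ)) =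
    ((∏ i, (Real.exp (-Real.pi * (‖r i‖ ^ 2 * (a i)⁻¹)) : ℂ)) *
        ∏ j, (Real.exp (-Real.pi * (‖c j‖ ^ 2 * (b j)⁻¹)) : ℂ)) *
      ∫ x : (ι → ℝ) × (κ → ℂ), (∏ i, (Real.exp (-Real.pi * (‖x.1 i‖ ^ 2 * a i)) : ℂ)) *
        ∏ j, (Real.exp (-Real.pi * (‖x.2 j‖ ^ 2 * b j)) : ℂ) := by
  let f (i : ι) (x : ℝ) : ℂ := Real.exp (-Real.pi * (‖x‖ ^ 2 * a i))
  let g (j : κ) (x : ℂ) : ℂ := Real.exp (-Real.pi * (‖x‖ ^ 2 * b j))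
  let f' (i : ι) (x : ℝ) : ℂ :=
    Complex.exp (2 * Real.pi * Complex.I * (inner ℝ (r i) x : ℝ)) * f i x
  let g' (j : κ) (x : ℂ) : ℂ :=
    Complex.exp (2 * Real.pi * Complex.I * (inner ℝ (c j) x : ℝ)) * g j x
  calc _ = ∫ x : (ι → ℝ) × (κ → ℂ), (∏ i, f' i (x.1 i)) * ∏ j, g' j (x.2 j) := by
        refine integral_congr_ae (Filter.Eventually.of_forall fun x => ?_)
        simp only [f', g', f, g, Finset.prod_mul_distrib]
        ring
    _ = (∏ i, ∫ x, f' i x) * ∏ j, ∫ x, g' j x := by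
        rw [Measure.volume_eq_prod, integral_prod_mul (fun x : ι → ℝ => ∏ i, f' i (x i))
          (fun x : κ → ℂ => ∏ j, g' j (x j)), integral_fintype_prod_volume_eq_prod,
          integral_fintype_prod_volume_eq_prod]
    _ = ((∏ i, (Real.exp (-Real.pi * (‖r i‖ ^ 2 * (a i)⁻¹)) : ℂ)) *
        ∏ j, (Real.exp (-Real.pi * (‖c j‖ ^ 2 * (b j)⁻¹)) : ℂ)) *
          ((∏ i, ∫ x, f i x) * ∏ j, ∫ x, g j x) := by
        rw [mul_mul_mul_comm, ← Finset.prod_mul_distrib, ← Finset.prod_mul_distrib]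
        congr 1
        · exact Finset.prod_congr rfl fun i _ => integral_cexp_gaussian_mul (ha i) (r i)
        · exact Finset.prod_congr rfl fun j _ => integral_cexp_gaussian_mul (hb j) (c j)
    _ = _ := by
        rw [Measure.volume_eq_prod, integral_prod_mul (fun x : ι → ℝ => ∏ i, f i (x i))
          (fun x : κ → ℂ => ∏ j, g j (x j)), integral_fintype_prod_volume_eq_prod,
          integral_fintype_prod_volume_eq_prod]

end Product

namespace ArakelovDivisor

variable {F : Type*} [Field F] [NumberField F]

open scoped Classical in
theorem trace_mixedSpace (x : mixedSpace F) : Algebra.trace ℝ (mixedSpace F) x =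
    ∑ w : {w : InfinitePlace F // w.IsReal}, x.1 w +
      ∑ w : {w : InfinitePlace F // w.IsComplex}, 2 * (x.2 w).re := by
  rw [Algebra.trace_prod_apply, Algebra.trace_pi_eq_sum, Algebra.trace_pi_eq_sum]
  simp only [Algebra.trace_self_apply, Algebra.trace_complex_apply]

open scoped Classical in
theorem isPositiveQuadratic_normSq (D : ArakelovDivisor F) : IsPositiveQuadratic D.normSq :=
  isPositiveQuadratic_sum (fun _ => Real.exp_pos _) fun _ => by positivity

open scoped Classical in
theorem gaussian_eq_prod (D : ArakelovDivisor F) (x : mixedSpace F) : D.gaussian x =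
    (∏ w : {w : InfinitePlace F // w.IsReal},
      Real.exp (-Real.pi * (‖x.1 w‖ ^ 2 * Real.exp (-2 * D.2 w)))) *
    ∏ w : {w : InfinitePlace F // w.IsComplex},
      Real.exp (-Real.pi * (‖x.2 w‖ ^ 2 * (2 * Real.exp (-D.2 w)))) := by
  rw [← Real.exp_sum, ← Real.exp_sum, ← Real.exp_add, ← Finset.mul_sum, ← Finset.mul_sum,
    ← mul_add]
  rfl

-- At a complex place the trace of `z w` is `2 Re (z w)`, the real inner product of `z` with `2 w̄`;
-- this is the frequency for the Gaussian Fourier transform.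
open scoped Classical in
theorem tracePairing_eq_prod (x y : mixedSpace F) : tracePairing x y =
    (∏ w : {w : InfinitePlace F // w.IsReal},
      Complex.exp (2 * Real.pi * Complex.I * (inner ℝ (y.1 w) (x.1 w) : ℝ))) *
    ∏ w : {w : InfinitePlace F // w.IsComplex},
      Complex.exp (2 * Real.pi * Complex.I * (inner ℝ (2 * star (y.2 w)) (x.2 w) : ℝ)) := by
  rw [← Complex.exp_sum, ← Complex.exp_sum, ← Complex.exp_add, ← Finset.mul_sum, ← Finset.mul_sum,
    ← mul_add, tracePairing, trace_mixedSpace]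
  congr 2
  push_cast
  congr 1
  refine Finset.sum_congr rfl fun w _ => ?_
  norm_cast
  simp only [Prod.snd_mul, Pi.mul_apply, Complex.inner, Complex.mul_re, Complex.mul_im, map_mul]
  simp
  ring

-- The transform inverts the weights. At a complex place the factor `2` is self-dual: `‖2 ȳ‖² / (2
-- exp (-x_σ)) = 2 exp (x_σ) ‖y‖²`.
open scoped Classical in
theorem integral_tracePairing_mul_gaussian (D E : ArakelovDivisor F) (hE : E.2 = -D.2)
    (y : mixedSpace F) : ∫ x, tracePairing x y * D.gaussian x =
      E.gaussian y * ∫ x, (D.gaussian x : ℂ) := by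
  have h := integral_prod_cexp_gaussian_mul
    (a := fun w : {w : InfinitePlace F // w.IsReal} => Real.exp (-2 * D.2 w))
    (b := fun w : {w : InfinitePlace F // w.IsComplex} => 2 * Real.exp (-D.2 w))
    (fun _ => Real.exp_pos _) (fun _ => by positivity) y.1 fun w => 2 * star (y.2 w)
  have hD (x : mixedSpace F) : (D.gaussian x : ℂ) =
      (∏ w, (Real.exp (-Real.pi * (‖x.1 w‖ ^ 2 * Real.exp (-2 * D.2 w))) : ℂ)) *
        ∏ w, (Real.exp (-Real.pi * (‖x.2 w‖ ^ 2 * (2 * Real.exp (-D.2 w)))) : ℂ) := by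
    rw [gaussian_eq_prod, Complex.ofReal_mul, Complex.ofReal_prod, Complex.ofReal_prod]
  have hE' : (E.gaussian y : ℂ) =
      (∏ w, (Real.exp (-Real.pi * (‖y.1 w‖ ^ 2 * (Real.exp (-2 * D.2 w))⁻¹)) : ℂ)) *
        ∏ w, (Real.exp (-Real.pi * (‖2 * star (y.2 w)‖ ^ 2 * (2 * Real.exp (-D.2 w))⁻¹)) : ℂ) := by
    rw [gaussian_eq_prod, Complex.ofReal_mul, Complex.ofReal_prod, Complex.ofReal_prod, hE]
    congr 1
    · refine Finset.prod_congr rfl fun w _ => ?_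
      rw [← Real.exp_neg, Pi.neg_apply, mul_neg, neg_mul]
    · refine Finset.prod_congr rfl fun w _ => ?_
      congr 3
      rw [norm_mul, norm_star, mul_inv, ← Real.exp_neg, Pi.neg_apply, Complex.norm_ofNat]
      ring
  simp_rw [tracePairing_eq_prod, hD]
  rw [hE']
  exact h

end ArakelovDivisor

/-! ### Serre duality for the ghost-spaces of a divisor -/

theorem GhostSpace.IsFirstKind.restrict {G : Type*} [AddCommGroup G] [TopologicalSpace G]
    {u : G → ℝ} (hu : IsFirstKind u) (L : AddSubgroup G) : IsFirstKind fun x : L => u x where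
  continuous := hu.continuous.comp continuous_subtype_val
  pos x := hu.pos x
  map_zero := hu.map_zero
  positiveDefinite n x := hu.positiveDefinite n fun i => x i

theorem Homeomorph.eq_map_iff {X Y : Type*} [TopologicalSpace X] [TopologicalSpace Y]
    [MeasurableSpace X] [MeasurableSpace Y] [BorelSpace X] [BorelSpace Y] (h : X ≃ₜ Y)
    (μ : Measure X) (ν : Measure Y) : ν = μ.map h ↔ ν.map h.symm = μ := by
  constructor
  · rintro rfl
    rw [Measure.map_map h.symm.continuous.measurable h.continuous.measurable,
      h.symm_comp_self, Measure.map_id]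
  · rintro rfl
    rw [Measure.map_map h.continuous.measurable h.symm.continuous.measurable,
      h.self_comp_symm, Measure.map_id]

namespace ArakelovDivisor

variable {F : Type*} [Field F] [NumberField F]

theorem isFirstKind_gaussian (D : ArakelovDivisor F) : IsFirstKind D.gaussian := by
  classical exact D.isPositiveQuadratic_normSq.isFirstKind_exp Real.pi_pos

theorem isFirstKind_effectivity (D : ArakelovDivisor F) : IsFirstKind D.effectivity :=
  D.isFirstKind_gaussian.restrict D.lattice

theorem isFirstKind_quotientGaussian (D : ArakelovDivisor F) :
    IsFirstKind D.quotientGaussian := by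
  classical
  exact D.isPositiveQuadratic_normSq.isFirstKind_quotientFun D.latticeBasis D.lattice
    (fun _ => D.mem_lattice_iff_mem_span) Real.pi_pos

theorem isSecondKind_omega (D : ArakelovDivisor F) : IsSecondKind D.omega := by
  classical
  exact D.isPositiveQuadratic_normSq.isSecondKind_quotientMeasure D.latticeBasis D.lattice
    (fun _ => D.mem_lattice_iff_mem_span) Real.pi_pos

theorem h1IsDefined (D : ArakelovDivisor F) : D.H1IsDefined where
  hasQuotient :=
    { closed := inferInstance
      firstKind := D.isFirstKind_gaussian
      integrable := by
        classical exact D.isPositiveQuadratic_normSq.integrable_exp_add D.lattice Real.pi_pos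
      quotient := D.isFirstKind_quotientGaussian }
  finiteDimensional := D.isFirstKind_quotientGaussian.continuous.integrable_of_hasCompactSupport
    (HasCompactSupport.of_compactSpace _)
  secondKind := D.isSecondKind_omega

instance (D : ArakelovDivisor F) : IsProbabilityMeasure D.omega := D.isSecondKind_omega.probability

theorem continuous_traceEquiv_eval (D : ArakelovDivisor F) (y : (canonical F - D).lattice) :
    Continuous fun a => (D.traceEquiv a).eval y :=
  AddDual.continuous_eval.comp (D.traceEquiv.continuous.prodMk continuous_const)

/-- Unfolding reduces this to the Fourier transform of the Gaussian of `D`, normalized by its total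
integral. -/
theorem integral_traceEquiv_eval_omega (D : ArakelovDivisor F) (y : (canonical F - D).lattice) :
    ∫ a, (D.traceEquiv a).eval y ∂D.omega = (canonical F - D).effectivity y := by
  classical
  have h := D.isPositiveQuadratic_normSq.integral_quotientMeasure_quotientFun D.latticeBasis
    D.lattice (fun _ => D.mem_lattice_iff_mem_span) Real.pi_pos volume
    (D.continuous_traceEquiv_eval y)
  refine h.trans ?_
  simp_rw [traceEquiv_mk_eval]
  -- The infinite coefficients of `K` vanish, so those of `K - D` are opposite to those of `D`.
  have h1 := integral_tracePairing_mul_gaussian D (canonical F - D) (by simp [canonical]) y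
  have h2 : ∫ x : mixedSpace F, (D.gaussian x : ℂ) ≠ 0 := by
    rw [integral_complex_ofReal]
    exact_mod_cast (D.isPositiveQuadratic_normSq.integral_exp_pos volume Real.pi_pos).ne'
  exact (div_eq_iff h2).mpr h1

theorem measure_ext_of_traceEquiv (D : ArakelovDivisor F)
    {P Q : Measure (mixedSpace F ⧸ D.lattice)} [IsFiniteMeasure P] [IsFiniteMeasure Q]
    (h : ∀ y, ∫ a, (D.traceEquiv a).eval y ∂P = ∫ a, (D.traceEquiv a).eval y ∂Q) : P = Q :=
  measure_ext_of_integral_eval_eq D.traceEquiv.injective D.continuous_traceEquiv_eval h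

theorem regular_of_isFiniteMeasure (D : ArakelovDivisor F)
    (P : Measure (mixedSpace F ⧸ D.lattice)) [IsFiniteMeasure P] : P.Regular :=
  letI := TopologicalSpace.metrizableSpaceMetric (mixedSpace F ⧸ D.lattice)
  inferInstance

theorem isFourierTransform_iff (D : ArakelovDivisor F)
    (ν : Measure (AddDual (canonical F - D).lattice)) :
    IsFourierTransform (canonical F - D).effectivity ν ↔ ν = D.omega.map D.traceEquiv := by
  let e : (mixedSpace F ⧸ D.lattice) ≃ₜ AddDual (canonical F - D).lattice :=
    D.traceEquiv.toHomeomorph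
  change _ ↔ ν = D.omega.map e
  constructor
  · rintro ⟨hfin, -, hinv⟩
    rw [e.eq_map_iff]
    refine D.measure_ext_of_traceEquiv fun y => ?_
    rw [integral_traceEquiv_eval_omega, hinv, e.symm.measurableEmbedding.integral_map]
    refine integral_congr_ae (Filter.Eventually.of_forall fun χ => ?_)
    exact congrArg (fun ψ => AddDual.eval ψ y) (e.apply_symm_apply χ)
  · rintro rfl
    have := D.regular_of_isFiniteMeasure D.omega
    refine ⟨Measure.isFiniteMeasure_map _ _, Measure.Regular.map e, fun y => ?_⟩
    rw [e.measurableEmbedding.integral_map]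
    exact (D.integral_traceEquiv_eval_omega y).symm

instance (D : ArakelovDivisor F) : CompactSpace (AddDual (canonical F - D).lattice) :=
  D.traceEquiv.toHomeomorph.compactSpace

/-- The homeomorphism `x ↦ (y ↦ exp (2 π i Tr (x y)) u y)` onto the space of symmetric
quasi-characters of `H⁰(K - D)`. -/
def serreHomeomorph (D : ArakelovDivisor F) :
    (mixedSpace F ⧸ D.lattice) ≃ₜ QuasiDual (canonical F - D).H0 :=
  D.traceEquiv.toHomeomorph.trans (quasiDualHomeomorph (canonical F - D).isFirstKind_effectivity)

theorem serreHomeomorph_apply (D : ArakelovDivisor F) (a : mixedSpace F ⧸ D.lattice)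
    (y : (canonical F - D).lattice) : (D.serreHomeomorph a).1 y =
      (D.traceEquiv a).eval y * ((canonical F - D).effectivity y : ℂ) := rfl

/-- Translation by `a + b` pulls out the character values at `a` and `b`. The remaining integral
against `ω` is `u y`, which joins the factor `u y` of the quasi-character to give the square
required on the right. -/
theorem integral_serreHomeomorph_H1 (D : ArakelovDivisor F) (a b : mixedSpace F ⧸ D.lattice)
    (y : (canonical F - D).lattice) : ∫ z, (D.serreHomeomorph z).1 y ∂(D.H1 a b) =
      (D.serreHomeomorph a).1 y * (D.serreHomeomorph b).1 y := by
  have hm : MeasurableEmbedding fun z : mixedSpace F ⧸ D.lattice => a + b + z :=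
    (Homeomorph.addLeft (a + b)).measurableEmbedding
  rw [H1, secondKind, hm.integral_map]
  simp only [serreHomeomorph_apply, map_add, AddDual.add_eval, mul_assoc]
  rw [integral_const_mul, integral_const_mul, integral_mul_const, integral_traceEquiv_eval_omega]
  ring

theorem isDuality_serreHomeomorph (D : ArakelovDivisor F) :
    IsDuality (canonical F - D).H0 D.H1 D.serreHomeomorph where
  map_neg a y := by
    simp only [serreHomeomorph_apply, map_neg, AddDual.neg_eval, star_mul',
      Complex.star_def, Complex.conj_ofReal]
  convolution a b ν := by
    have : IsFiniteMeasure (D.H1 a b) := Measure.isFiniteMeasure_map _ _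
    have hu (y) : ((canonical F - D).effectivity y : ℂ) ≠ 0 := by
      exact_mod_cast ((canonical F - D).isFirstKind_effectivity.pos y).ne'
    constructor
    · rintro ⟨hfin, -, hinv⟩
      rw [Homeomorph.eq_map_iff]
      -- The nonzero factor `u y` does not depend on the integration variable; multiplying by it
      -- turns characters into quasi-characters, to which the inversion formula applies.
      refine D.measure_ext_of_traceEquiv fun y => mul_right_cancel₀ (hu y) ?_
      rw [← integral_mul_const, ← integral_mul_const]
      simp_rw [← serreHomeomorph_apply]
      rw [integral_serreHomeomorph_H1, hinv,
        D.serreHomeomorph.symm.measurableEmbedding.integral_map]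
      simp
    · rintro rfl
      have := D.regular_of_isFiniteMeasure (D.H1 a b)
      refine ⟨Measure.isFiniteMeasure_map _ _, Measure.Regular.map _, fun y => ?_⟩
      rw [D.serreHomeomorph.measurableEmbedding.integral_map, integral_serreHomeomorph_H1]

end ArakelovDivisor

end

/-- Serre duality: for every Arakelov divisor `D` of a number field, `H¹(D)` is the Pontryagin dual
of `H⁰(K - D)`. -/
theorem theorem5p2 {F : Type*} [Field F] [NumberField F] (D : ArakelovDivisor F) :
    -- the ideal of `K - D` is the inverse of the different times the inverse of the ideal of `D`
    (((ArakelovDivisor.canonical F - D).ideal : FractionalIdeal (𝓞 F)⁰ F) =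
      (differentIdeal ℤ (𝓞 F) : FractionalIdeal (𝓞 F)⁰ F)⁻¹ *
        (D.ideal : FractionalIdeal (𝓞 F)⁰ F)⁻¹) ∧
    -- `H⁰(K - D)` is a ghost-space of the first kind, `H¹(D)` one of the second kind
    GhostSpace.IsFirstKind (ArakelovDivisor.canonical F - D).effectivity ∧
    D.H1IsDefined ∧
    -- duality of the underlying groups, through the trace pairing
    ∃ e : (mixedEmbedding.mixedSpace F ⧸ D.lattice) ≃ₜ+
        GhostSpace.AddDual (ArakelovDivisor.canonical F - D).lattice,
      (∀ (x : mixedEmbedding.mixedSpace F) (y : (ArakelovDivisor.canonical F - D).lattice),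
        (e x).eval y = ArakelovDivisor.tracePairing x y) ∧
      -- `ω` corresponds to the Fourier transform of `u`
      (∀ ν : Measure (GhostSpace.AddDual (ArakelovDivisor.canonical F - D).lattice),
        GhostSpace.IsFourierTransform (ArakelovDivisor.canonical F - D).effectivity ν ↔ ν = D.omega.map e) ∧
      -- duality of the convolution structures
      ∃ Φ : (mixedEmbedding.mixedSpace F ⧸ D.lattice) ≃ₜ
          GhostSpace.QuasiDual (ArakelovDivisor.canonical F - D).H0,
        (∀ (a : mixedEmbedding.mixedSpace F ⧸ D.lattice)
            (y : (ArakelovDivisor.canonical F - D).lattice),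
          (Φ a).1 y = (e a).eval y * ((ArakelovDivisor.canonical F - D).effectivity y : ℂ)) ∧
        GhostSpace.IsDuality (ArakelovDivisor.canonical F - D).H0 D.H1 Φ :=
  ⟨D.coe_ideal_canonical_sub, (ArakelovDivisor.canonical F - D).isFirstKind_effectivity,
    D.h1IsDefined, D.traceEquiv, D.traceEquiv_mk_eval, D.isFourierTransform_iff,
    D.serreHomeomorph, D.serreHomeomorph_apply, D.isDuality_serreHomeomorph⟩
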